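/- Let $X$ be a complex Banach space; $B_X$, $S_X$ denote its closed unit ball and unit sphere, and $X$ is regarded as a subspace of $X^{**}$ in the canonical way. Let $\mathcal A_{wu}(B_X)$ be the space of all functions $f:B_X\to\mathbb C$ that are weakly uniformly continuous on $B_X$ and holomorphic on its interior, and let $\mathcal A_{w^*u}(B_{X^{**}})$ be the space of all functions $F:B_{X^{**}}\to\mathbb C$ that are weak-star uniformly continuous on $B_{X^{**}}$ and holomorphic on its interior, both with the supremum norm $\|\cdot\|_\infty$. A point $z\in S_{X^{**}}$ is a strong peak point for $\mathcal A_{w^*u}(B_{X^{**}})$ with respect to the norm if there is $h\in\mathcal A_{w^*u}(B_{X^{**}})$ with $\|h\|_\infty=|h(z)|=1$ and $\sup\{|h(y)|: y\in B_{X^{**}},\ \|y-z\|\ge\delta\}<1$ for every $\delta>0$; let $\Gamma_s(B_{X^{**}})$ be the set of these points. For $g\in\mathcal A_{wu}(B_X)$, the Aron–Berner extension $ABg$ of $g$ is the norm-continuous function on $B_{X^{**}}$ given on the open unit ball by $ABg(z)=\sum_{n\ge0}\frac1{n!}\widetilde{d^ng(0)}(z,\dots,z)$, where for a continuous $n$-linear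 form $A$ on $X$ the form $\widetilde A$ on $X^{**}$ is $\widetilde A(z_1,\dots,z_n)=\lim_{x_1\to z_1}\cdots\lim_{x_n\to z_n}A(x_1,\dots,x_n)$ (iterated weak-star limits with $x_i\in X$). Suppose that $\Gamma_s(B_{X^{**}})$ is norm dense in $S_{X^{**}}$. Then for every $\varepsilon>0$ there is $\eta(\varepsilon)>0$ such that whenever $f\in\mathcal A_{wu}(B_X)$ with $\|f\|_\infty=1$ and $x_0\in S_X$ satisfy $$|f(x_0)|>1-\eta(\varepsilon),$$ there are $g\in\mathcal A_{wu}(B_X)$ with $\|g\|_\infty=1$, whose Aron–Berner extension $ABg$ exists and belongs to $\mathcal A_{w^*u}(B_{X^{**}})$, and $z_0^{**}\in S_{X^{**}}$ such that $$|ABg(z_0^{**})|=1,\qquad \|g-f\|_\infty<\varepsilon,\qquad \|z_0^{**}-x_0\|<\varepsilon .$$ -/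

import Mathlib

open Set Filter Topology Metric

noncomputable section

section BallAlgebras

variable {E : Type*} [NormedAddCommGroup E] [NormedSpace ℂ E]

/-- The supremum norm `sup {|f x| : ‖x‖ ≤ 1}`. Functions on the closed unit ball are represented by
functions on the whole space, of which only the values on the closed unit ball matter. -/
def ballNorm (f : E → ℂ) : ℝ := ⨆ x : closedBall (0 : E) 1, ‖f x‖

/-- `f ∈ A_wu(B_E)`: `f` is weakly uniformly continuous on the closed unit ball of `E` and
holomorphic (complex Fréchet differentiable) on the open unit ball. -/
structure MemAwu (f : E → ℂ) : Prop where
  weak_uniform : ∀ ε > 0, ∃ V ∈ 𝓝 (0 : WeakSpace ℂ E),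
    ∀ x ∈ closedBall (0 : E) 1, ∀ y ∈ closedBall (0 : E) 1,
      toWeakSpace ℂ E (x - y) ∈ V → ‖f x - f y‖ < ε
  holomorphic : DifferentiableOn ℂ f (ball (0 : E) 1)

/-- `f ∈ A_{w*u}(B_{E*})`: `f` is weak-star uniformly continuous on the closed unit ball of the dual
`E*` and holomorphic (complex Fréchet differentiable) on the open unit ball of `E*`. -/
structure MemAwstaru (f : StrongDual ℂ E → ℂ) : Prop where
  weakstar_uniform : ∀ ε > 0, ∃ V ∈ 𝓝 (0 : WeakDual ℂ E),
    ∀ x ∈ closedBall (0 : StrongDual ℂ E) 1, ∀ y ∈ closedBall (0 : StrongDual ℂ E) 1,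
      StrongDual.toWeakDual (x - y) ∈ V → ‖f x - f y‖ < ε
  holomorphic : DifferentiableOn ℂ f (ball (0 : StrongDual ℂ E) 1)

/-- `Γ_s(B_{E*})`: the points of the unit sphere of `E*` that are strong peak points for
`A_{w*u}(B_{E*})` with respect to the norm. -/
def normStrongPeakPoints (E : Type*) [NormedAddCommGroup E] [NormedSpace ℂ E] :
    Set (StrongDual ℂ E) :=
  {z | ‖z‖ = 1 ∧ ∃ f : StrongDual ℂ E → ℂ, MemAwstaru f ∧ ballNorm f = 1 ∧ ‖f z‖ = 1 ∧
    ∀ δ > 0, sSup ((fun y => ‖f y‖) '' (closedBall (0 : StrongDual ℂ E) 1 \ ball z δ)) < 1}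

/-- The supremum defining the norm of a function in `A_{w*u}(B_{E*})` is finite. -/
theorem MemAwstaru.bddAbove {f : StrongDual ℂ E → ℂ} (hf : MemAwstaru f) :
    BddAbove (range fun x : closedBall (0 : StrongDual ℂ E) 1 => ‖f x‖) := by
  obtain ⟨V, hV, h⟩ := hf.weakstar_uniform 1 one_pos
  have hK : IsCompact (WeakDual.toStrongDual ⁻¹' closedBall (0 : StrongDual ℂ E) 1) :=
    WeakDual.isCompact_closedBall 0 1
  obtain ⟨t, htK, ht⟩ := hK.elim_nhds_subcover (fun b => (fun x : WeakDual ℂ E => x - b) ⁻¹' V)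
    (fun b _ => (continuous_id.sub continuous_const).continuousAt.preimage_mem_nhds
      (by simpa using hV))
  refine ⟨∑ b ∈ t, ‖f (WeakDual.toStrongDual b)‖ + 1, ?_⟩
  rintro _ ⟨⟨x, hx⟩, rfl⟩
  obtain ⟨b, hbt, hb⟩ := mem_iUnion₂.1 (ht (show StrongDual.toWeakDual x ∈ _ from hx))
  have h1 := h x hx (WeakDual.toStrongDual b) (htK b hbt) hb
  have h2 : ‖f (WeakDual.toStrongDual b)‖ ≤ ∑ b ∈ t, ‖f (WeakDual.toStrongDual b)‖ :=
    Finset.single_le_sum (f := fun b => ‖f (WeakDual.toStrongDual b)‖)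
      (fun _ _ => norm_nonneg _) hbt
  have h3 := norm_sub_norm_le (f x) (f (WeakDual.toStrongDual b))
  simp only
  linarith

/-- The supremum defining the norm of a function in `A_wu(B_E)` is finite. -/
theorem MemAwu.bddAbove {f : E → ℂ} (hf : MemAwu f) :
    BddAbove (range fun x : closedBall (0 : E) 1 => ‖f x‖) := by
  obtain ⟨V, hV, h⟩ := hf.weak_uniform 1 one_pos
  let J := NormedSpace.inclusionInDoubleDualWeak ℂ E
  have hJ : IsEmbedding J := NormedSpace.isEmbedding_inclusionInDoubleDualWeak ℂ E
  rw [hJ.nhds_eq_comap, map_zero] at hV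
  obtain ⟨W, hW, hWV⟩ := mem_comap.1 hV
  let S : Set (WeakDual ℂ (StrongDual ℂ E)) := (fun x : E => J (toWeakSpace ℂ E x)) '' closedBall 0 1
  have hS : S ⊆ WeakDual.toStrongDual ⁻¹' closedBall (0 : StrongDual ℂ (StrongDual ℂ E)) 1 := by
    rintro _ ⟨x, hx, rfl⟩
    rw [mem_closedBall_zero_iff] at hx
    have hle : ‖NormedSpace.inclusionInDoubleDual ℂ E x‖ ≤ 1 :=
      (NormedSpace.double_dual_bound ℂ E x).trans hx
    exact (mem_closedBall_zero_iff (E := StrongDual ℂ (StrongDual ℂ E))).2 hle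
  have hK : IsCompact (closure S) :=
    (WeakDual.isCompact_closedBall (0 : StrongDual ℂ (StrongDual ℂ E)) 1).closure_of_subset hS
  let U : WeakDual ℂ (StrongDual ℂ E) → Set (WeakDual ℂ (StrongDual ℂ E)) :=
    fun b => (fun x => x - b) ⁻¹' interior W
  have hU : ∀ b, IsOpen (U b) := fun b =>
    isOpen_interior.preimage
      (show Continuous fun x : WeakDual ℂ (StrongDual ℂ E) => x - b by fun_prop)
  have hcov : closure S ⊆ ⋃ b ∈ S, U b := by
    intro k hk
    have hN : (fun b => k - b) ⁻¹' interior W ∈ 𝓝 k :=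
      (show Continuous fun b => k - b by fun_prop).continuousAt.preimage_mem_nhds
        (by rw [sub_self]; exact interior_mem_nhds.2 hW)
    obtain ⟨b, hb, hbS⟩ := mem_closure_iff_nhds.1 hk _ hN
    exact mem_iUnion₂.2 ⟨b, hbS, hb⟩
  obtain ⟨t, htS, htf, ht⟩ := hK.elim_finite_subcover_image (fun b _ => hU b) hcov
  choose! p hp hpb using fun b (hb : b ∈ t) => htS hb
  refine ⟨∑ b ∈ htf.toFinset, ‖f (p b)‖ + 1, ?_⟩
  rintro _ ⟨⟨x, hx⟩, rfl⟩
  obtain ⟨b, hbt, hb⟩ := mem_iUnion₂.1 (ht (subset_closure ⟨x, hx, rfl⟩))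
  have h1 := h x hx (p b) (hp b hbt) (hWV (by
    rw [mem_preimage, map_sub, map_sub]
    have := hpb b hbt
    simp only at this
    rw [this]
    exact interior_subset hb))
  have h2 : ‖f (p b)‖ ≤ ∑ b ∈ htf.toFinset, ‖f (p b)‖ :=
    Finset.single_le_sum (f := fun b => ‖f (p b)‖)
      (fun _ _ => norm_nonneg _) (htf.mem_toFinset.2 hbt)
  have h3 := norm_sub_norm_le (f x) (f (p b))
  simp only
  linarith

end BallAlgebras

section AronBerner

variable {X : Type*} [NormedAddCommGroup X] [NormedSpace ℂ X]

/-- The Aron–Berner (Arens) extension `Ã(z₀, …, zₙ₋₁)` of a continuous `n`-linear form `A` on `X` to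
the bidual, as a continuous linear functional of `A`. The variables are extended one after the other,
from the last one to the first one: `Ã(z₀, z₁, …) = z₀ (x ↦ (A(x, ·, …, ·))~(z₁, …))`, that is,
`Ã(z₀, …, zₙ₋₁) = lim_{x₀ → z₀} ⋯ lim_{xₙ₋₁ → zₙ₋₁} A(x₀, …, xₙ₋₁)` with weak-star limits. -/
def aronBernerForm : (n : ℕ) → (Fin n → StrongDual ℂ (StrongDual ℂ X)) →
    (ContinuousMultilinearMap ℂ (fun _ : Fin n => X) ℂ →L[ℂ] ℂ)
  | 0, _ => ContinuousMultilinearMap.apply ℂ (fun _ : Fin 0 => X) ℂ 0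
  | n + 1, z =>
    (z 0).comp
      ((ContinuousLinearMap.compL ℂ X (ContinuousMultilinearMap ℂ (fun _ : Fin n => X) ℂ) ℂ
          (aronBernerForm n (Fin.tail z))).comp
        ((continuousMultilinearCurryLeftEquiv ℂ (fun _ : Fin (n + 1) => X) ℂ :
            ContinuousMultilinearMap ℂ (fun _ : Fin (n + 1) => X) ℂ ≃L[ℂ]
              (X →L[ℂ] ContinuousMultilinearMap ℂ (fun _ : Fin n => X) ℂ)) :
          ContinuousMultilinearMap ℂ (fun _ : Fin (n + 1) => X) ℂ →L[ℂ]
            (X →L[ℂ] ContinuousMultilinearMap ℂ (fun _ : Fin n => X) ℂ)))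

/-- `F` is the Aron–Berner extension of `f` to the closed unit ball of `X**`: on the open unit ball
it is the sum of the Aron–Berner extensions of the homogeneous Taylor polynomials
`x ↦ (1/n!) dⁿf(0)(x, …, x)` of `f` at `0`, and it is norm continuous on the closed unit ball. -/
structure IsAronBernerExtension (f : X → ℂ) (F : StrongDual ℂ (StrongDual ℂ X) → ℂ) : Prop where
  hasSum : ∀ z ∈ ball (0 : StrongDual ℂ (StrongDual ℂ X)) 1,
    HasSum (fun n : ℕ =>
      ((n.factorial : ℂ)⁻¹) * aronBernerForm n (fun _ => z) (iteratedFDeriv ℂ n f 0)) (F z)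
  continuousOn : ContinuousOn F (closedBall (0 : StrongDual ℂ (StrongDual ℂ X)) 1)

theorem aronBernerForm_succ_apply {n : ℕ} (z : Fin (n + 1) → StrongDual ℂ (StrongDual ℂ X))
    (A : ContinuousMultilinearMap ℂ (fun _ : Fin (n + 1) => X) ℂ) :
    aronBernerForm (n + 1) z A = z 0 ((aronBernerForm n (Fin.tail z)).comp A.curryLeft) := rfl

/-- The Aron–Berner extension of a form does extend it. -/
theorem aronBernerForm_inclusion {n : ℕ} (x : Fin n → X)
    (A : ContinuousMultilinearMap ℂ (fun _ : Fin n => X) ℂ) :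
    aronBernerForm n (fun i => NormedSpace.inclusionInDoubleDual ℂ X (x i)) A = A x := by
  induction n with
  | zero =>
    change A 0 = A x
    congr 1
    exact Subsingleton.elim _ _
  | succ n ih =>
    rw [aronBernerForm_succ_apply, NormedSpace.dual_def]
    change aronBernerForm n _ (A.curryLeft (x 0)) = _
    refine (ih (Fin.tail x) (A.curryLeft (x 0))).trans ?_
    rw [ContinuousMultilinearMap.curryLeft_apply, Fin.cons_self_tail]

/-- The Aron–Berner extension to the closed unit ball of `X**` is unique. -/
theorem IsAronBernerExtension.unique {f : X → ℂ} {F G : StrongDual ℂ (StrongDual ℂ X) → ℂ}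
    (hF : IsAronBernerExtension f F) (hG : IsAronBernerExtension f G) :
    EqOn F G (closedBall (0 : StrongDual ℂ (StrongDual ℂ X)) 1) := by
  have h : EqOn F G (ball (0 : StrongDual ℂ (StrongDual ℂ X)) 1) :=
    fun z hz => (hF.hasSum z hz).unique (hG.hasSum z hz)
  refine h.of_subset_closure hF.continuousOn hG.continuousOn ball_subset_closedBall ?_
  let _ : NormedSpace ℝ (StrongDual ℂ (StrongDual ℂ X)) := NormedSpace.restrictScalars ℝ ℂ _
  exact (closure_ball (0 : StrongDual ℂ (StrongDual ℂ X)) one_ne_zero).ge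

end AronBerner

end

/-!
Functions of `A_wu(B_X)` and of `A_w*u(B_X**)` are the same thing: `f` extends to `B_X**` by
weak-star limits, and a function `G` on `B_X**` restricts to `X`. Hence it is enough to perturb on
`B_X**`, which is weak-star compact, so that every function of the algebra attains its norm there.

The perturbation (`exists_memAwstaru_norm_attaining`): let `F` be the extension of `f`, and suppose
that `|F|` exceeds `1 - ε/8` at `x₀`. By density there is a strong peak point `z` near `x₀` where
this persists. With `h` a peak function at `z`, add to `F` the function `(ε/4) h ^ n` times a phase.
At `z` the modulus becomes larger than `1 + ε/8`, whereas away from `z` it stays below this value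
when `n` is large; so every maximum of the modulus lies near `z`. It can be moved to the sphere
along its radius by the maximum modulus principle, and normalising the sum gives the required function.

Two facts about the identification of the algebras carry the rest.

* The extension of `f` is Fréchet holomorphic on the open ball of `X**`
  (`MemAwu.memAwstaru_bidualExtension`). By the Cauchy estimates the derivative of `f` is weakly
  uniformly continuous with values in the norm of `X*`, so it converges in norm as `x` tends
  weak-star to a point `a` of the ball of `X**`. Its limit, an element of `X*`, is the derivative of
  the extension at `a`, because the quadratic bound on the Taylor remainder passes to weak-star
  limits.
* `G` is the Aron–Berner extension of its restriction to `X` (`MemAwstaru.isAronBernerExtension`).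
  The directional derivatives of `G` are again weak-star uniformly continuous on smaller balls, and
  the first derivative at a point is then evaluation at an element of `X*`. Extending the variables
  of `dⁿG` one after the other, an induction identifies the Aron–Berner extension of the `n`-th
  derivative of the restriction with the `n`-th derivative of `G`; the Taylor series of `G` does the
  rest.

The estimates come from the Schwarz lemma, and so does the fact, needed for the second point, that a
holomorphic function with values in a Banach space is infinitely differentiable
(`DifferentiableOn.fderiv_of_complex`).
-/

/-! ### Holomorphic functions between Banach spaces -/

section Holomorphic

variable {E G : Type*} [NormedAddCommGroup E] [NormedSpace ℂ E]
  [NormedAddCommGroup G] [NormedSpace ℂ G]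

theorem hasFDerivAt_of_norm_sub_le_sq {f : E → G} {L : E →L[ℂ] G} {a : E} {σ C : ℝ} (hσ : 0 < σ)
    (h : ∀ u, ‖u‖ < σ → ‖f (a + u) - f a - L u‖ ≤ C * ‖u‖ ^ 2) : HasFDerivAt f L a := by
  rw [hasFDerivAt_iff_isLittleO_nhds_zero]
  have h1 : (fun u => f (a + u) - f a - L u) =O[𝓝 0] fun u : E => ‖u‖ ^ 2 := by
    refine Asymptotics.IsBigO.of_bound C ?_
    filter_upwards [ball_mem_nhds (0 : E) hσ] with u hu
    simpa using h u (by simpa using hu)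
  refine h1.trans_isLittleO ?_
  simpa using (Asymptotics.isLittleO_norm_pow_id (E' := E) one_lt_two)

/-- Cauchy estimate for the first derivative. -/
theorem norm_fderiv_le_of_norm_le_on_ball {f : E → G} {a : E} {σ M : ℝ} (hσ : 0 < σ)
    (hd : DifferentiableOn ℂ f (ball a σ)) (hM : ∀ z ∈ ball a σ, ‖f z‖ ≤ M) :
    ‖fderiv ℂ f a‖ ≤ 2 * M / σ := by
  refine Complex.norm_fderiv_le_div_of_mapsTo_ball hd (fun z hz => ?_) hσ
  rw [mem_closedBall, dist_eq_norm]
  linarith [norm_sub_le (f z) (f a), hM z hz, hM a (mem_ball_self hσ)]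

/-- The remainder of the first order Taylor expansion of a bounded holomorphic function is
quadratic, with a constant that depends only on the bound and on the radius. -/
theorem norm_taylor_one_remainder_le {f : E → G} {a w : E} {σ M : ℝ}
    (hd : DifferentiableOn ℂ f (ball a σ)) (hM : ∀ z ∈ ball a σ, ‖f z‖ ≤ M) (hw : ‖w‖ < σ) :
    ‖f (a + w) - f a - fderiv ℂ f a w‖ ≤ 4 * M / σ ^ 2 * ‖w‖ ^ 2 := by
  have hσ : 0 < σ := (norm_nonneg w).trans_lt hw
  have hfa := hd.differentiableAt (ball_mem_nhds a hσ)
  have hC := norm_fderiv_le_of_norm_le_on_ball hσ hd hM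
  have key := Complex.dist_le_mul_div_pow_of_mapsTo_ball_of_isLittleO (n := 1) (R₁ := σ)
    (R₂ := 4 * M) (c := a) (z := a + w) (f := fun z => f z - fderiv ℂ f a (z - a))
    (hd.sub (by fun_prop)) ?_ ?_ (by simpa using hw)
  · simp only [dist_eq_norm, sub_self, map_zero, sub_zero, add_sub_cancel_left] at key
    calc _ = ‖f (a + w) - fderiv ℂ f a w - f a‖ := by congr 1; abel
      _ ≤ _ := key
      _ = _ := by ring
  · intro z hz
    simp only [mem_closedBall, dist_eq_norm, sub_self, map_zero, sub_zero]
    have h1 : ‖fderiv ℂ f a (z - a)‖ ≤ 2 * M := by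
      have hz' : ‖z - a‖ ≤ σ := by simpa [dist_eq_norm] using (mem_ball.1 hz).le
      calc _ ≤ ‖fderiv ℂ f a‖ * ‖z - a‖ := ContinuousLinearMap.le_opNorm _ _
        _ ≤ 2 * M / σ * σ := mul_le_mul hC hz' (norm_nonneg _) ((norm_nonneg _).trans hC)
        _ = 2 * M := by field_simp
    have h2 := norm_sub_le (f z - fderiv ℂ f a (z - a)) (f a)
    have h3 := norm_sub_le (f z) (fderiv ℂ f a (z - a))
    linarith [hM z hz, hM a (mem_ball_self hσ)]
  · have := hfa.hasFDerivAt.isLittleO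
    simp only [sub_self, map_zero, sub_zero, pow_one]
    refine (this.norm_right).congr_left fun z => ?_
    abel

/-- If two translates of a holomorphic function are uniformly close on a ball, then its derivatives
at the two centres are close in operator norm. -/
theorem norm_fderiv_sub_fderiv_le {f : E → G} {a b : E} {σ ε : ℝ} (hσ : 0 < σ)
    (ha : DifferentiableOn ℂ f (ball a σ)) (hb : DifferentiableOn ℂ f (ball b σ))
    (h : ∀ w ∈ ball (0 : E) σ, ‖f (a + w) - f (b + w)‖ ≤ ε) :
    ‖fderiv ℂ f a - fderiv ℂ f b‖ ≤ 2 * ε / σ := by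
  have hm : ∀ c : E, MapsTo (fun w => c + w) (ball 0 σ) (ball c σ) := fun c w hw => by
    simpa using hw
  have hd : ∀ c : E, DifferentiableOn ℂ f (ball c σ) →
      DifferentiableOn ℂ (fun w => f (c + w)) (ball 0 σ) := fun c hc =>
    hc.comp (by fun_prop) (hm c)
  have h0 : ∀ c : E, DifferentiableOn ℂ f (ball c σ) →
      HasFDerivAt (fun w => f (c + w)) (fderiv ℂ f c) 0 := fun c hc => by
    have h1 : HasFDerivAt f (fderiv ℂ f c) (c + 0) := by
      rw [add_zero]; exact (hc.differentiableAt (ball_mem_nhds c hσ)).hasFDerivAt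
    simpa [Function.comp_def] using h1.comp (0 : E) ((hasFDerivAt_id (0 : E)).const_add c)
  have key := norm_fderiv_le_of_norm_le_on_ball hσ ((hd a ha).sub (hd b hb)) h
  rwa [((h0 a ha).sub (h0 b hb)).fderiv] at key

/-- A uniform limit of holomorphic functions with values in a Banach space is holomorphic, because
the derivatives converge uniformly on smaller balls by the Cauchy estimate. -/
theorem differentiableAt_of_tendstoUniformlyOn_ball [CompleteSpace G] {ι : Type*} {l : Filter ι}
    [l.NeBot] {F : ι → E → G} {g : E → G} {a : E} {σ : ℝ} (hσ : 0 < σ)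
    (hF : ∀ᶠ i in l, DifferentiableOn ℂ (F i) (ball a σ))
    (hg : TendstoUniformlyOn F g l (ball a σ)) : DifferentiableAt ℂ g a := by
  have hσ2 : 0 < σ / 2 := by linarith
  have hsub : ∀ z ∈ ball a (σ / 2), ball z (σ / 2) ⊆ ball a σ := fun z hz =>
    ball_subset_ball' (by linarith [mem_ball.1 hz])
  have hC : UniformCauchySeqOn (fun i => fderiv ℂ (F i)) l (ball a (σ / 2)) := by
    intro u hu
    obtain ⟨ε, hε, hεu⟩ := Metric.mem_uniformity_dist.1 hu
    have hε' : 0 < ε * σ / 8 := by positivity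
    have h1 := hg.uniformCauchySeqOn _ (Metric.dist_mem_uniformity hε')
    filter_upwards [h1, hF.prod_mk hF] with p hp hd z hz
    have hzσ := hsub z hz
    have hdz : ∀ i, DifferentiableOn ℂ (F i) (ball a σ) → DifferentiableAt ℂ (F i) z := fun i hi =>
      hi.differentiableAt (isOpen_ball.mem_nhds (hzσ (mem_ball_self hσ2)))
    have h2 := norm_fderiv_le_of_norm_le_on_ball (f := F p.1 - F p.2) (a := z) (M := ε * σ / 8) hσ2
      ((hd.1.sub hd.2).mono hzσ) (fun w hw => by
        have : dist (F p.1 w) (F p.2 w) < ε * σ / 8 := hp w (hzσ hw)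
        rw [dist_eq_norm] at this
        exact this.le)
    rw [fderiv_sub (hdz _ hd.1) (hdz _ hd.2)] at h2
    refine hεu ?_
    rw [dist_eq_norm]
    refine h2.trans_lt ?_
    have : 2 * (ε * σ / 8) / (σ / 2) = ε / 2 := by field_simp; ring
    linarith
  have hlim : ∀ z ∈ ball a (σ / 2), ∃ L, Tendsto (fun i => fderiv ℂ (F i) z) l (𝓝 L) :=
    fun z hz => cauchy_map_iff_exists_tendsto.1 (hC.cauchy_map hz)
  choose! L hL using hlim
  have hU := hC.tendstoUniformlyOn_of_tendsto hL
  have hnhds := ball_mem_nhds a hσ2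
  have hUF := (tendstoUniformlyOn_iff_tendstoUniformlyOnFilter.1 hU).mono_right
    (le_principal_iff.2 hnhds)
  refine (hasFDerivAt_of_tendstoUniformlyOnFilter (f := F) (g := g) hUF ?_ ?_).differentiableAt
  · filter_upwards [hF.prod_mk (eventually_mem_set.2 hnhds)] with p hp
    exact (hp.1.differentiableAt
      (isOpen_ball.mem_nhds (hsub _ hp.2 (mem_ball_self hσ2)))).hasFDerivAt
  · filter_upwards [hnhds] with z hz
    exact hg.tendsto_at (hsub z hz (mem_ball_self hσ2))

/-- The derivative in a fixed direction of a bounded holomorphic function is holomorphic, as a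
uniform limit of difference quotients. -/
theorem differentiableAt_fderiv_apply [CompleteSpace G] {f : E → G} {a : E} {σ M : ℝ} (hσ : 0 < σ)
    (hd : DifferentiableOn ℂ f (ball a (2 * σ))) (hM : ∀ z ∈ ball a (2 * σ), ‖f z‖ ≤ M) (v : E) :
    DifferentiableAt ℂ (fun z => fderiv ℂ f z v) a := by
  have hsub : ∀ z ∈ ball a σ, ball z σ ⊆ ball a (2 * σ) := fun z hz =>
    ball_subset_ball' (by linarith [mem_ball.1 hz])
  have hM0 : 0 ≤ M := (norm_nonneg _).trans (hM a (mem_ball_self (by linarith)))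
  have hsmall : ∀ᶠ t : ℂ in 𝓝[≠] 0, ‖t • v‖ < σ := by
    have : Tendsto (fun t : ℂ => ‖t • v‖) (𝓝[≠] 0) (𝓝 0) := by
      have h : Continuous fun t : ℂ => ‖t • v‖ := by fun_prop
      simpa using (h.tendsto 0).mono_left nhdsWithin_le_nhds
    exact this.eventually (gt_mem_nhds hσ)
  refine differentiableAt_of_tendstoUniformlyOn_ball (l := 𝓝[≠] (0 : ℂ))
    (F := fun t z => t⁻¹ • (f (z + t • v) - f z)) hσ ?_ ?_
  · filter_upwards [hsmall] with t ht
    refine DifferentiableOn.const_smul (DifferentiableOn.sub (hd.comp (by fun_prop) ?_)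
      (hd.mono (ball_subset_ball (by linarith)))) _
    intro z hz
    exact hsub z hz (by simpa using ht)
  · rw [Metric.tendstoUniformlyOn_iff]
    intro ε hε
    have hlim : Tendsto (fun t : ℂ => 4 * M / σ ^ 2 * ‖v‖ ^ 2 * ‖t‖) (𝓝[≠] 0) (𝓝 0) := by
      have h : Continuous fun t : ℂ => 4 * M / σ ^ 2 * ‖v‖ ^ 2 * ‖t‖ := by fun_prop
      simpa using (h.tendsto 0).mono_left nhdsWithin_le_nhds
    filter_upwards [hsmall, hlim.eventually (gt_mem_nhds hε), self_mem_nhdsWithin] with t ht hte ht0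
      z hz
    have ht0' : t ≠ 0 := ht0
    have hq := norm_taylor_one_remainder_le (hd.mono (hsub z hz))
      (fun w hw => hM w (hsub z hz hw)) ht
    rw [dist_eq_norm, norm_sub_rev]
    have heq : t⁻¹ • (f (z + t • v) - f z) - fderiv ℂ f z v =
        t⁻¹ • (f (z + t • v) - f z - fderiv ℂ f z (t • v)) := by
      rw [smul_sub _ (f (z + t • v) - f z), map_smul, inv_smul_smul₀ ht0']
    rw [heq, norm_smul, norm_inv]
    refine lt_of_le_of_lt ?_ hte
    rw [inv_mul_le_iff₀ (norm_pos_iff.2 ht0')]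
    refine hq.trans_eq ?_
    rw [norm_smul]
    ring

/-- The derivative of a holomorphic function is holomorphic for the operator norm: the directional
derivatives are, with a bound on their Taylor remainders that is uniform in the direction. -/
theorem DifferentiableOn.fderiv_of_complex [CompleteSpace G] {f : E → G} {U : Set E}
    (hU : IsOpen U) (hf : DifferentiableOn ℂ f U) : DifferentiableOn ℂ (fderiv ℂ f) U := by
  intro a ha
  refine DifferentiableAt.differentiableWithinAt ?_
  obtain ⟨R, hR, hRU, hRM⟩ : ∃ R > 0, ball a R ⊆ U ∧ ∀ z ∈ ball a R, ‖f z‖ ≤ ‖f a‖ + 1 := by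
    have h1 : ∀ᶠ z in 𝓝 a, ‖f z‖ < ‖f a‖ + 1 :=
      (hf.differentiableAt (hU.mem_nhds ha)).continuousAt.norm.eventually
        (gt_mem_nhds (lt_add_one _))
    obtain ⟨R, hR, h⟩ := Metric.eventually_nhds_iff_ball.1 (h1.and (hU.eventually_mem ha))
    exact ⟨R, hR, fun z hz => (h z hz).2, fun z hz => (h z hz).1.le⟩
  set M := ‖f a‖ + 1
  obtain ⟨σ, hσ, rfl⟩ : ∃ σ > 0, R = 3 * σ := ⟨R / 3, by positivity, by ring⟩
  have hsub : ∀ z ∈ ball a σ, ball z (2 * σ) ⊆ ball a (3 * σ) := fun z hz =>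
    ball_subset_ball' (by linarith [mem_ball.1 hz])
  have hd3 := hf.mono hRU
  have hg : ∀ v, DifferentiableOn ℂ (fun z => fderiv ℂ f z v) (ball a σ) := fun v z hz =>
    (differentiableAt_fderiv_apply hσ (hd3.mono (hsub z hz))
      (fun w hw => hRM w (hsub z hz hw)) v).differentiableWithinAt
  have hgM : ∀ v, ∀ z ∈ ball a σ, ‖fderiv ℂ f z v‖ ≤ 2 * M / (2 * σ) * ‖v‖ := fun v z hz =>
    ContinuousLinearMap.le_of_opNorm_le _ (norm_fderiv_le_of_norm_le_on_ball (by linarith)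
      (hd3.mono (hsub z hz)) (fun w hw => hRM w (hsub z hz hw))) v
  have hga : ∀ v, DifferentiableAt ℂ (fun z => fderiv ℂ f z v) a := fun v =>
    (hg v).differentiableAt (ball_mem_nhds a hσ)
  let T : E →ₗ[ℂ] E →L[ℂ] G :=
    { toFun := fun v => fderiv ℂ (fun z => fderiv ℂ f z v) a
      map_add' := fun v w => by
        have h : (fun z => fderiv ℂ f z (v + w)) =
            (fun z => fderiv ℂ f z v) + fun z => fderiv ℂ f z w := by
          ext z; exact map_add _ _ _
        rw [h]
        exact fderiv_add (hga v) (hga w)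
      map_smul' := fun c v => by
        have h : (fun z => fderiv ℂ f z (c • v)) = c • fun z => fderiv ℂ f z v := by
          ext z; exact map_smul _ _ _
        rw [h, RingHom.id_apply]
        exact fderiv_const_smul (hga v) c }
  let S : E →L[ℂ] E →L[ℂ] G := T.mkContinuous (2 * (2 * M / (2 * σ)) / σ) fun v => by
    refine (norm_fderiv_le_of_norm_le_on_ball hσ (hg v) (hgM v)).trans_eq ?_
    ring
  refine (hasFDerivAt_of_norm_sub_le_sq (L := S.flip) hσ
    (C := 4 * (2 * M / (2 * σ)) / σ ^ 2) fun u hu => ?_).differentiableAt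
  refine ContinuousLinearMap.opNorm_le_bound _ (by positivity) fun v => ?_
  have h := norm_taylor_one_remainder_le (hg v) (hgM v) hu
  have hS : (fderiv ℂ f (a + u) - fderiv ℂ f a - S.flip u) v =
      fderiv ℂ f (a + u) v - fderiv ℂ f a v - fderiv ℂ (fun z => fderiv ℂ f z v) a u := rfl
  rw [hS]
  refine h.trans_eq ?_
  ring

theorem DifferentiableOn.iteratedFDeriv_of_complex [CompleteSpace G] {f : E → G} {U : Set E}
    (hU : IsOpen U) (hf : DifferentiableOn ℂ f U) (n : ℕ) :
    DifferentiableOn ℂ (iteratedFDeriv ℂ n f) U := by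
  induction n with
  | zero =>
    rw [iteratedFDeriv_zero_eq_comp]
    exact (LinearIsometryEquiv.differentiable _).comp_differentiableOn hf
  | succ n ih =>
    rw [iteratedFDeriv_succ_eq_comp_left]
    have h := DifferentiableOn.fderiv_of_complex hU ih
    exact (LinearIsometryEquiv.comp_differentiableOn_iff _).2 h

theorem DifferentiableOn.contDiffOn_of_complex [CompleteSpace G] {f : E → G} {U : Set E}
    (hU : IsOpen U) (hf : DifferentiableOn ℂ f U) (n : ℕ∞) : ContDiffOn ℂ n f U :=
  contDiffOn_of_differentiableOn fun m _ =>
    (hf.iteratedFDeriv_of_complex hU m).congr fun _ hx => iteratedFDerivWithin_of_isOpen m hU hx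

/-- The Taylor series at `0` of a holomorphic function on the unit ball of a Banach space converges
to it there, because it does so on every complex line through `0`. -/
theorem DifferentiableOn.hasSum_taylor_of_complex [CompleteSpace G] {f : E → G}
    (hf : DifferentiableOn ℂ f (ball 0 1)) {z : E} (hz : z ∈ ball (0 : E) 1) :
    HasSum (fun n : ℕ => ((n.factorial : ℂ)⁻¹) • iteratedFDeriv ℂ n f 0 (fun _ => z)) (f z) := by
  have hz1 : ‖z‖ < 1 := by simpa using hz
  have hz0 := norm_nonneg z
  let J : ℂ →L[ℂ] E := ContinuousLinearMap.toSpanSingleton ℂ z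
  have hJ : IsOpen (J ⁻¹' ball 0 1) := isOpen_ball.preimage J.continuous
  -- The disc of radius `2 / (1 + ‖z‖) > 1` is mapped into the unit ball by `t ↦ t • z`.
  have hpre : ball (0 : ℂ) (2 / (1 + ‖z‖)) ⊆ J ⁻¹' ball 0 1 := by
    intro t ht
    have ht' : ‖t‖ < 2 / (1 + ‖z‖) := by simpa using ht
    rw [lt_div_iff₀ (by positivity)] at ht'
    have : ‖t‖ * ‖z‖ < 1 := by nlinarith [norm_nonneg t]
    simpa [J, norm_smul] using this
  have hd : DifferentiableOn ℂ (f ∘ J) (ball 0 (2 / (1 + ‖z‖))) :=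
    hf.comp J.differentiable.differentiableOn hpre
  have h1 : (1 : ℂ) ∈ ball (0 : ℂ) (2 / (1 + ‖z‖)) := by
    rw [mem_ball_zero_iff, norm_one, one_lt_div (by positivity)]
    linarith
  have key := Complex.hasSum_taylorSeries_on_ball hd h1
  simp only [sub_zero, one_pow, one_smul] at key
  have e1 : (f ∘ J) 1 = f z := by simp [J]
  rw [e1] at key
  refine key.congr_fun ?_
  intro n
  have hJ0 : J 0 ∈ ball (0 : E) 1 := by simp
  have h2 := J.iteratedFDerivWithin_comp_right (hf.contDiffOn_of_complex isOpen_ball n)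
    isOpen_ball.uniqueDiffOn hJ.uniqueDiffOn hJ0 le_rfl
  rw [iteratedFDerivWithin_of_isOpen n hJ hJ0, iteratedFDerivWithin_of_isOpen n isOpen_ball hJ0]
    at h2
  rw [iteratedDeriv_eq_iteratedFDeriv, h2]
  simp [J]

end Holomorphic

noncomputable section

/-! ### Goldstine's theorem and weakly uniformly continuous functions -/

section Goldstine

/-- The dual of `X` as a normed space. This synonym of `StrongDual ℂ X` carries the algebraic and
topological structures which it has as a normed space, so that lemmas on the dual `StrongDual ℂ E`
of a normed space `E` apply to the bidual `StrongDual ℂ (NormedDual X)` of `X`. -/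
def NormedDual (X : Type*) [NormedAddCommGroup X] [NormedSpace ℂ X] : Type _ := StrongDual ℂ X

variable {X : Type*} [NormedAddCommGroup X] [NormedSpace ℂ X]

instance : NormedAddCommGroup (NormedDual X) :=
  inferInstanceAs (NormedAddCommGroup (StrongDual ℂ X))

instance : NormedSpace ℂ (NormedDual X) := inferInstanceAs (NormedSpace ℂ (StrongDual ℂ X))

/-- The canonical embedding of `X` into its bidual. -/
def toBidual (X : Type*) [NormedAddCommGroup X] [NormedSpace ℂ X] :
    X →L[ℂ] StrongDual ℂ (NormedDual X) := NormedSpace.inclusionInDoubleDual ℂ X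

theorem norm_toBidual (x : X) : ‖toBidual X x‖ = ‖x‖ :=
  (NormedSpace.inclusionInDoubleDualLi (𝕜 := ℂ) (E := X)).norm_map x

/-- A point outside the weak-star closure of a convex set is strictly separated from it by an
evaluation functional. -/
theorem exists_re_lt_of_notMem_closure {E : Type*} [NormedAddCommGroup E] [NormedSpace ℂ E]
    {S : Set (WeakDual ℂ E)} (hS : Convex ℝ S) {z : WeakDual ℂ E} (hz : z ∉ closure S) :
    ∃ (φ : E) (u : ℝ), (∀ w ∈ S, (w φ).re < u) ∧ u < (z φ).re := by
  have : ContinuousSMul ℝ (WeakBilin (topDualPairing ℂ E)) := IsScalarTower.continuousSMul ℂ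
  have hS' : Convex ℝ (E := WeakBilin (topDualPairing ℂ E)) S := hS
  obtain ⟨Φ, u, hΦ, hu⟩ := RCLike.geometric_hahn_banach_closed_point (𝕜 := ℂ)
    (E := WeakBilin (topDualPairing ℂ E)) hS'.closure isClosed_closure hz
  obtain ⟨φ, rfl⟩ := LinearMap.dualEmbedding_surjective (topDualPairing ℂ E) Φ
  exact ⟨φ, u, fun w hw => hΦ w (subset_closure hw), hu⟩

/-- **Goldstine's theorem**: the closed ball of radius `r` of `X` is weak-star dense in the one of
`X**`. -/
theorem toWeakDual_mem_closure_image_closedBall {r : ℝ} {z : StrongDual ℂ (NormedDual X)}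
    (hz : ‖z‖ ≤ r) :
    StrongDual.toWeakDual z ∈ closure
      ((fun x : X => StrongDual.toWeakDual (toBidual X x)) '' closedBall 0 r) := by
  have hr : 0 ≤ r := (norm_nonneg z).trans hz
  by_contra hcon
  set S := (fun x : X => StrongDual.toWeakDual (toBidual X x)) '' closedBall 0 r
  have hS : Convex ℝ S := by
    rintro _ ⟨x, hx, rfl⟩ _ ⟨y, hy, rfl⟩ s t hs ht hst
    refine ⟨(s : ℂ) • x + (t : ℂ) • y, ?_, ?_⟩
    · rw [mem_closedBall_zero_iff] at hx hy ⊢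
      calc _ ≤ ‖(s : ℂ) • x‖ + ‖(t : ℂ) • y‖ := norm_add_le _ _
        _ = s * ‖x‖ + t * ‖y‖ := by
          rw [norm_smul, norm_smul, Complex.norm_of_nonneg hs, Complex.norm_of_nonneg ht]
        _ ≤ s * r + t * r := by gcongr
        _ = r := by rw [← add_mul, hst, one_mul]
    · simp only [map_add, map_smul]
      rfl
  obtain ⟨φ, u, hΦ, hu⟩ := exists_re_lt_of_notMem_closure hS hcon
  change u < (z φ).re at hu
  let ψ : StrongDual ℂ X := φ
  have hx : ∀ x : X, ‖x‖ ≤ r → ‖ψ x‖ ≤ u := fun x hx => by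
    obtain ⟨c, hc, hcx⟩ : ∃ c : ℂ, ‖c‖ = 1 ∧ c * ψ x = ‖ψ x‖ := by
      obtain ⟨c, hc, h⟩ := RCLike.exists_norm_eq_mul_self (ψ x)
      exact ⟨c, hc, h.symm⟩
    have h := hΦ _ (mem_image_of_mem _
      (show c • x ∈ closedBall (0 : X) r by rw [mem_closedBall_zero_iff, norm_smul, hc]; simpa))
    change (ψ (c • x)).re < u at h
    rw [map_smul, smul_eq_mul, hcx] at h
    simpa using h.le
  have hle : (z φ).re ≤ ‖z‖ * ‖φ‖ := (Complex.re_le_norm _).trans (z.le_opNorm φ)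
  rcases hr.eq_or_lt with rfl | hr
  · have h0 := hx 0 (by simp)
    rw [map_zero, norm_zero] at h0
    have : ‖z‖ = 0 := le_antisymm hz (norm_nonneg _)
    rw [this, zero_mul] at hle
    linarith
  · have h0 : 0 ≤ u := (norm_nonneg _).trans (hx 0 (by simpa using hr.le))
    have hφu : ‖φ‖ ≤ u / r := by
      refine ContinuousLinearMap.opNorm_le_bound _ (by positivity) fun x => ?_
      rcases eq_or_ne x 0 with rfl | hx0
      · change ‖ψ 0‖ ≤ _
        simp
      have hxn : 0 < ‖x‖ := norm_pos_iff.2 hx0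
      have h := hx ((r / ‖x‖ : ℂ) • x) (by
        rw [norm_smul, norm_div, Complex.norm_of_nonneg hr.le, Complex.norm_real, norm_norm,
          div_mul_cancel₀ _ hxn.ne'])
      rw [map_smul, norm_smul, norm_div, Complex.norm_of_nonneg hr.le, Complex.norm_real,
        norm_norm, div_mul_eq_mul_div, div_le_iff₀ hxn] at h
      rw [div_mul_eq_mul_div, le_div_iff₀ hr, mul_comm]
      exact h
    have : ‖z‖ * ‖φ‖ ≤ r * (u / r) := mul_le_mul hz hφu (norm_nonneg _) hr.le
    rw [mul_div_cancel₀ _ hr.ne'] at this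
    linarith

/-- The filter on `X` along which `x` tends weak-star to the point `z` of `X**` while staying in the
closed ball of radius `r`. -/
def bidualNhds (r : ℝ) (z : StrongDual ℂ (NormedDual X)) : Filter X :=
  comap (fun x => StrongDual.toWeakDual (toBidual X x))
    (𝓝 (StrongDual.toWeakDual z)) ⊓ 𝓟 (closedBall 0 r)

theorem bidualNhds_neBot {r : ℝ} {z : StrongDual ℂ (NormedDual X)} (hz : ‖z‖ ≤ r) :
    (bidualNhds r z).NeBot := by
  have h := toWeakDual_mem_closure_image_closedBall hz
  rw [mem_closure_iff_nhds] at h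
  refine inf_principal_neBot_iff.2 fun U hU => ?_
  obtain ⟨V, hV, hVU⟩ := mem_comap.1 hU
  obtain ⟨_, hx, x, hxr, rfl⟩ := h V hV
  exact ⟨x, hVU hx, hxr⟩

theorem tendsto_bidualNhds (r : ℝ) (z : StrongDual ℂ (NormedDual X)) :
    Tendsto (fun x => StrongDual.toWeakDual (toBidual X x)) (bidualNhds r z)
      (𝓝 (StrongDual.toWeakDual z)) :=
  tendsto_comap.mono_left inf_le_left

theorem eventually_norm_le_bidualNhds (r : ℝ) (z : StrongDual ℂ (NormedDual X)) :
    ∀ᶠ x in bidualNhds r z, ‖x‖ ≤ r := by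
  filter_upwards [mem_inf_of_right (mem_principal_self (closedBall (0 : X) r))] with x hx
  simpa using hx

theorem bidualNhds_mono {r s : ℝ} (h : r ≤ s) (z : StrongDual ℂ (NormedDual X)) :
    bidualNhds r z ≤ bidualNhds s z :=
  inf_le_inf_left _ (principal_mono.2 (closedBall_subset_closedBall h))

theorem tendsto_apply_bidualNhds (r : ℝ) (z : StrongDual ℂ (NormedDual X))
    (φ : StrongDual ℂ X) : Tendsto φ (bidualNhds r z) (𝓝 (z φ)) :=
  ((WeakDual.eval_continuous (𝕜 := ℂ) (E := NormedDual X) φ).tendsto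
    (StrongDual.toWeakDual z)).comp (tendsto_bidualNhds r z)

theorem tendsto_add_bidualNhds (r s : ℝ) (z w : StrongDual ℂ (NormedDual X)) :
    Tendsto (fun p : X × X => p.1 + p.2) (bidualNhds r z ×ˢ bidualNhds s w)
      (bidualNhds (r + s) (z + w)) := by
  refine tendsto_inf.2 ⟨tendsto_comap_iff.2 ?_, tendsto_principal.2 ?_⟩
  · have h := ((tendsto_bidualNhds r z).comp tendsto_fst).add
      ((tendsto_bidualNhds s w).comp (tendsto_snd (f := bidualNhds r z)))
    rw [← map_add] at h
    refine h.congr fun p => ?_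
    simp
  · filter_upwards [(eventually_norm_le_bidualNhds r z).prod_mk
      (eventually_norm_le_bidualNhds s w)] with p hp
    rw [mem_closedBall_zero_iff]
    exact (norm_add_le _ _).trans (add_le_add hp.1 hp.2)

theorem tendsto_sub_bidualNhds (r s : ℝ) (z w : StrongDual ℂ (NormedDual X)) :
    Tendsto (fun p : X × X => StrongDual.toWeakDual (toBidual X (p.1 - p.2)))
      (bidualNhds r z ×ˢ bidualNhds s w) (𝓝 (StrongDual.toWeakDual (z - w))) := by
  have h := ((tendsto_bidualNhds r z).comp tendsto_fst).sub
    ((tendsto_bidualNhds s w).comp (tendsto_snd (f := bidualNhds r z)))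
  rw [← map_sub] at h
  refine h.congr fun p => ?_
  simp

/-- Every weak neighbourhood of `0` is the trace on `X` of a weak-star neighbourhood of `0`. -/
theorem exists_toWeakDual_nhds {V : Set (WeakSpace ℂ X)} (hV : V ∈ 𝓝 0) :
    ∃ W : Set (WeakDual ℂ (NormedDual X)), IsOpen W ∧ 0 ∈ W ∧
      ∀ x : X, StrongDual.toWeakDual (toBidual X x) ∈ W → toWeakSpace ℂ X x ∈ V := by
  rw [(NormedSpace.isEmbedding_inclusionInDoubleDualWeak ℂ X).nhds_eq_comap, map_zero] at hV
  obtain ⟨W, hW, hWV⟩ := mem_comap.1 hV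
  obtain ⟨W', hW', ho, h0⟩ := mem_nhds_iff.1 hW
  exact ⟨W', ho, h0, fun x hx => hWV (hW' hx)⟩

variable {Y : Type*} [NormedAddCommGroup Y]

/-- `f` is weakly uniformly continuous on the closed ball of radius `r` of `X`. -/
def WeakUniformContinuousOnBall (r : ℝ) (f : X → Y) : Prop :=
  ∀ ε > 0, ∃ V ∈ 𝓝 (0 : WeakSpace ℂ X), ∀ x ∈ closedBall (0 : X) r, ∀ y ∈ closedBall (0 : X) r,
    toWeakSpace ℂ X (x - y) ∈ V → ‖f x - f y‖ < ε

/-- A weakly uniformly continuous function converges along every bounded weak-star convergent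
filter. -/
theorem WeakUniformContinuousOnBall.exists_tendsto [CompleteSpace Y] {r : ℝ} {f : X → Y}
    (hf : WeakUniformContinuousOnBall r f) {z : StrongDual ℂ (NormedDual X)} (hz : ‖z‖ ≤ r) :
    ∃ y, Tendsto f (bidualNhds r z) (𝓝 y) := by
  have := bidualNhds_neBot hz
  refine cauchy_map_iff_exists_tendsto.1 (cauchy_map_iff.2 ⟨this, ?_⟩)
  rw [Metric.uniformity_basis_dist.tendsto_right_iff]
  intro ε hε
  obtain ⟨V, hV, h⟩ := hf ε hε
  obtain ⟨W, hWo, hW0, hWV⟩ := exists_toWeakDual_nhds hV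
  have h1 := (tendsto_sub_bidualNhds r r z z).eventually
    (hWo.mem_nhds (by rwa [sub_self, map_zero]))
  filter_upwards [h1, (eventually_norm_le_bidualNhds r z).prod_mk
    (eventually_norm_le_bidualNhds r z)] with p hp hpr
  rw [dist_eq_norm]
  exact h p.1 (by simpa using hpr.1) p.2 (by simpa using hpr.2) (hWV _ hp)

theorem WeakUniformContinuousOnBall.tendsto_inclusion {r : ℝ} {f : X → Y}
    (hf : WeakUniformContinuousOnBall r f) {x : X} (hx : ‖x‖ ≤ r) :
    Tendsto f (bidualNhds r (toBidual X x)) (𝓝 (f x)) := by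
  rw [Metric.nhds_basis_ball.tendsto_right_iff]
  intro ε hε
  obtain ⟨V, hV, h⟩ := hf ε hε
  obtain ⟨W, hWo, hW0, hWV⟩ := exists_toWeakDual_nhds hV
  have h1 : Tendsto (fun y : X => StrongDual.toWeakDual (toBidual X (y - x)))
      (bidualNhds r (toBidual X x)) (𝓝 0) := by
    have := (tendsto_bidualNhds r (toBidual X x)).sub_const
      (StrongDual.toWeakDual (toBidual X x))
    rw [sub_self] at this
    refine this.congr fun p => ?_
    simp
  filter_upwards [h1.eventually (hWo.mem_nhds hW0), eventually_norm_le_bidualNhds r _] with y hy hyr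
  rw [mem_ball, dist_eq_norm]
  exact h y (by simpa using hyr) x (by simpa using hx) (hWV _ hy)

/-- The derivative of a holomorphic, weakly uniformly continuous function is weakly uniformly
continuous on smaller balls, for the operator norm. -/
theorem WeakUniformContinuousOnBall.fderiv {f : X → ℂ} (hf : WeakUniformContinuousOnBall 1 f)
    (hd : DifferentiableOn ℂ f (ball 0 1)) {r : ℝ} (hr : r < 1) :
    WeakUniformContinuousOnBall r (fderiv ℂ f) := by
  intro ε hε
  have hσ : 0 < 1 - r := by linarith
  obtain ⟨V, hV, h⟩ := hf (ε * (1 - r) / 4) (by positivity)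
  refine ⟨V, hV, fun x hx y hy hxy => ?_⟩
  have hsub : ∀ z ∈ closedBall (0 : X) r, ball z (1 - r) ⊆ ball 0 1 := fun z hz =>
    ball_subset_ball' (by linarith [mem_closedBall.1 hz])
  have hb : ∀ z ∈ closedBall (0 : X) r, ∀ w ∈ ball (0 : X) (1 - r), z + w ∈ closedBall (0 : X) 1 :=
    fun z hz w hw => ball_subset_closedBall (hsub z hz (by simpa using hw))
  have key := norm_fderiv_sub_fderiv_le (f := f) (a := x) (b := y) (ε := ε * (1 - r) / 4) hσ
    (hd.mono (hsub x hx)) (hd.mono (hsub y hy))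
    fun w hw => (h _ (hb x hx w hw) _ (hb y hy w hw) (by simpa using hxy)).le
  refine key.trans_lt ?_
  have : 2 * (ε * (1 - r) / 4) / (1 - r) = ε / 2 := by field_simp; ring
  linarith

end Goldstine

/-! ### Extension from the ball of `X` to the ball of `X**` -/

section Extension

variable {X : Type*} [NormedAddCommGroup X] [NormedSpace ℂ X]

/-- The extension by weak-star limits of a weakly uniformly continuous function on the closed unit
ball of `X` to the closed unit ball of `X**`. Outside that ball its values are junk. -/
def bidualExtension (f : X → ℂ) (z : StrongDual ℂ (NormedDual X)) : ℂ :=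
  limUnder (bidualNhds 1 z) f

theorem tendsto_bidualExtension {f : X → ℂ} (hf : WeakUniformContinuousOnBall 1 f)
    {z : StrongDual ℂ (NormedDual X)} (hz : ‖z‖ ≤ 1) {r : ℝ} (hr : r ≤ 1) :
    Tendsto f (bidualNhds r z) (𝓝 (bidualExtension f z)) :=
  (tendsto_nhds_limUnder (hf.exists_tendsto hz)).mono_left (bidualNhds_mono hr z)

theorem bidualExtension_toBidual {f : X → ℂ} (hf : WeakUniformContinuousOnBall 1 f) {x : X}
    (hx : ‖x‖ ≤ 1) : bidualExtension f (toBidual X x) = f x := by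
  have hx' : ‖toBidual X x‖ ≤ 1 := by rwa [norm_toBidual]
  have := bidualNhds_neBot hx'
  exact tendsto_nhds_unique (tendsto_bidualExtension hf hx' le_rfl) (hf.tendsto_inclusion hx)

theorem norm_bidualExtension_le {f : X → ℂ} (hf : WeakUniformContinuousOnBall 1 f) {M : ℝ}
    (hM : ∀ x : X, ‖x‖ ≤ 1 → ‖f x‖ ≤ M) {z : StrongDual ℂ (NormedDual X)} (hz : ‖z‖ ≤ 1) :
    ‖bidualExtension f z‖ ≤ M := by
  have := bidualNhds_neBot hz
  refine le_of_tendsto (tendsto_bidualExtension hf hz le_rfl).norm ?_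
  filter_upwards [eventually_norm_le_bidualNhds 1 z] with x hx
  exact hM x hx

/-- The derivative of the extension at a point `a` of the open unit ball of `X**` is the evaluation
at the limit in `X*` of the derivatives of `f` at points that tend weak-star to `a`. -/
theorem exists_hasFDerivAt_bidualExtension {f : X → ℂ} (hf : WeakUniformContinuousOnBall 1 f)
    (hd : DifferentiableOn ℂ f (ball 0 1)) {M : ℝ} (hM : ∀ x : X, ‖x‖ ≤ 1 → ‖f x‖ ≤ M)
    {a : StrongDual ℂ (NormedDual X)} (ha : ‖a‖ < 1) :
    ∃ D : StrongDual ℂ X,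
      HasFDerivAt (bidualExtension f)
        (ContinuousLinearMap.apply ℂ ℂ (show NormedDual X from D)) a := by
  set σ := 1 - ‖a‖ with hσ_def
  have hσ : 0 < σ := by linarith
  have := bidualNhds_neBot (le_refl ‖a‖)
  obtain ⟨D, hD⟩ := (hf.fderiv hd ha).exists_tendsto le_rfl
  refine ⟨D, hasFDerivAt_of_norm_sub_le_sq hσ (C := 4 * M / σ ^ 2) fun b hb => ?_⟩
  have := bidualNhds_neBot (le_refl ‖b‖)
  have hab : ‖a‖ + ‖b‖ ≤ 1 := by linarith
  have h1 : Tendsto (fun p : X × X => f (p.1 + p.2)) (bidualNhds ‖a‖ a ×ˢ bidualNhds ‖b‖ b)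
      (𝓝 (bidualExtension f (a + b))) :=
    (tendsto_bidualExtension hf ((norm_add_le a b).trans hab) hab).comp
      (tendsto_add_bidualNhds ‖a‖ ‖b‖ a b)
  have h2 : Tendsto (fun p : X × X => f p.1) (bidualNhds ‖a‖ a ×ˢ bidualNhds ‖b‖ b)
      (𝓝 (bidualExtension f a)) :=
    (tendsto_bidualExtension hf ha.le ha.le).comp tendsto_fst
  have h3 : Tendsto (fun p : X × X => fderiv ℂ f p.1 p.2)
      (bidualNhds ‖a‖ a ×ˢ bidualNhds ‖b‖ b) (𝓝 (b (show NormedDual X from D))) := by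
    have h4 : Tendsto (fun p : X × X => D p.2) (bidualNhds ‖a‖ a ×ˢ bidualNhds ‖b‖ b)
        (𝓝 (b (show NormedDual X from D))) :=
      (tendsto_apply_bidualNhds ‖b‖ b D).comp tendsto_snd
    have h5 : Tendsto (fun p : X × X => ‖fderiv ℂ f p.1 - D‖ * ‖b‖)
        (bidualNhds ‖a‖ a ×ˢ bidualNhds ‖b‖ b) (𝓝 0) := by
      have := ((tendsto_iff_norm_sub_tendsto_zero.1 hD).comp
        (tendsto_fst (g := bidualNhds ‖b‖ b))).mul_const ‖b‖
      rwa [zero_mul] at this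
    have h6 : Tendsto (fun p : X × X => (fderiv ℂ f p.1 - D) p.2)
        (bidualNhds ‖a‖ a ×ˢ bidualNhds ‖b‖ b) (𝓝 0) := by
      refine squeeze_zero_norm' ?_ h5
      filter_upwards [(eventually_norm_le_bidualNhds ‖b‖ b).prod_inr _] with p hp
      exact ContinuousLinearMap.le_opNorm_of_le _ hp
    simpa using h6.add h4
  refine le_of_tendsto ((h1.sub h2).sub h3).norm ?_
  filter_upwards [(eventually_norm_le_bidualNhds ‖a‖ a).prod_mk
    (eventually_norm_le_bidualNhds ‖b‖ b)] with p hp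
  have hsub : ball p.1 σ ⊆ ball 0 1 := ball_subset_ball' (by
    rw [dist_zero_right]; linarith [hp.1])
  have hM0 : 0 ≤ M := (norm_nonneg _).trans (hM 0 (by simp))
  refine (norm_taylor_one_remainder_le (hd.mono hsub)
    (fun z hz => hM z (by simpa using (mem_ball.1 (hsub hz)).le)) (hp.2.trans_lt hb)).trans ?_
  gcongr
  exact hp.2

/-- The extension to `X**` of a function of `A_wu(B_X)` belongs to `A_w*u(B_X**)`. -/
theorem MemAwu.memAwstaru_bidualExtension {f : X → ℂ} (hf : MemAwu f) :
    MemAwstaru (E := NormedDual X) (bidualExtension f) := by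
  have hu : WeakUniformContinuousOnBall 1 f := hf.weak_uniform
  refine ⟨fun ε hε => ?_, fun a ha => ?_⟩
  · obtain ⟨V, hV, h⟩ := hu (ε / 2) (half_pos hε)
    obtain ⟨W, hWo, hW0, hWV⟩ := exists_toWeakDual_nhds hV
    refine ⟨W, hWo.mem_nhds hW0, fun z hz w hw hzw => ?_⟩
    rw [mem_closedBall_zero_iff] at hz hw
    have := bidualNhds_neBot hz
    have := bidualNhds_neBot hw
    have h1 := ((tendsto_bidualExtension hu hz le_rfl).comp
      (tendsto_fst (g := bidualNhds 1 w))).sub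
      ((tendsto_bidualExtension hu hw le_rfl).comp (tendsto_snd (f := bidualNhds 1 z)))
    refine (le_of_tendsto h1.norm ?_).trans_lt (half_lt_self hε)
    filter_upwards [(tendsto_sub_bidualNhds 1 1 z w).eventually (hWo.mem_nhds hzw),
      (eventually_norm_le_bidualNhds 1 z).prod_mk (eventually_norm_le_bidualNhds 1 w)] with p hp hpr
    exact (h p.1 (by simpa using hpr.1) p.2 (by simpa using hpr.2) (hWV _ hp)).le
  · obtain ⟨M, hM⟩ := hf.bddAbove
    obtain ⟨D, hD⟩ := exists_hasFDerivAt_bidualExtension hu hf.holomorphic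
      (fun x hx => hM ⟨⟨x, by simpa using hx⟩, rfl⟩) (by simpa using ha)
    exact hD.differentiableAt.differentiableWithinAt

end Extension

/-! ### Aron–Berner extensions of the derivatives -/

section AronBernerSeries

/-- If a holomorphic function takes close values along two complex lines through `c`, then its
derivatives at `c` in the directions of these lines are close. -/
theorem norm_fderiv_apply_sub_le {F : Type*} [NormedAddCommGroup F] [NormedSpace ℂ F] {f : F → ℂ}
    {U : Set F} (hU : IsOpen U) (hf : DifferentiableOn ℂ f U) {c v w : F} {σ ε : ℝ} (hσ : 0 < σ)
    (hv : ∀ t ∈ ball (0 : ℂ) σ, c + t • v ∈ U) (hw : ∀ t ∈ ball (0 : ℂ) σ, c + t • w ∈ U)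
    (h : ∀ t ∈ ball (0 : ℂ) σ, ‖f (c + t • v) - f (c + t • w)‖ ≤ ε) :
    ‖fderiv ℂ f c v - fderiv ℂ f c w‖ ≤ 2 * ε / σ := by
  have hc : c ∈ U := by simpa using hv 0 (mem_ball_self hσ)
  have hd : ∀ u : F, (∀ t ∈ ball (0 : ℂ) σ, c + t • u ∈ U) →
      DifferentiableOn ℂ (fun t : ℂ => f (c + t • u)) (ball 0 σ) := fun u hu =>
    hf.comp (by fun_prop) hu
  have hder : ∀ u : F, HasFDerivAt (fun t : ℂ => f (c + t • u))
      ((fderiv ℂ f c).comp (ContinuousLinearMap.toSpanSingleton ℂ u)) 0 := by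
    intro u
    have h0 : HasFDerivAt (fun t : ℂ => c + t • u)
        (ContinuousLinearMap.toSpanSingleton ℂ u) 0 :=
      (ContinuousLinearMap.toSpanSingleton ℂ u).hasFDerivAt.const_add c
    have h1 : HasFDerivAt f (fderiv ℂ f c) (c + (0 : ℂ) • u) := by
      rw [zero_smul, add_zero]
      exact (hf.differentiableAt (hU.mem_nhds hc)).hasFDerivAt
    exact h1.comp (0 : ℂ) h0
  have key := norm_fderiv_le_of_norm_le_on_ball hσ ((hd v hv).sub (hd w hw)) h
  rw [((hder v).sub (hder w)).fderiv] at key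
  simpa using ContinuousLinearMap.le_of_opNorm_le _ key 1

theorem toWeakDual_add_smul_sub_add_smul {E : Type*} [NormedAddCommGroup E] [NormedSpace ℂ E]
    (c v w : StrongDual ℂ E) (t : ℂ) :
    StrongDual.toWeakDual (c + t • v - (c + t • w)) = t • StrongDual.toWeakDual (v - w) := by
  rw [← map_smul, smul_sub, add_sub_add_left_eq_sub]

/-- `G` is holomorphic on the open unit ball of `E*` and weak-star uniformly continuous on the
closed balls of radius less than `1`. This class contains `A_w*u(B_{E*})` and, unlike it, is stable
under directional derivatives. -/
structure LocallyWeakStarUniform {E : Type*} [NormedAddCommGroup E] [NormedSpace ℂ E]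
    (G : StrongDual ℂ E → ℂ) : Prop where
  holomorphic : DifferentiableOn ℂ G (ball 0 1)
  weakstar_uniform : ∀ r < 1, ∀ ε > 0, ∃ V ∈ 𝓝 (0 : WeakDual ℂ E),
    ∀ x ∈ closedBall (0 : StrongDual ℂ E) r, ∀ y ∈ closedBall (0 : StrongDual ℂ E) r,
      StrongDual.toWeakDual (x - y) ∈ V → ‖G x - G y‖ < ε

section

variable {E : Type*} [NormedAddCommGroup E] [NormedSpace ℂ E] {G : StrongDual ℂ E → ℂ}

theorem MemAwstaru.locallyWeakStarUniform (hG : MemAwstaru G) : LocallyWeakStarUniform G where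
  holomorphic := hG.holomorphic
  weakstar_uniform r hr ε hε := by
    obtain ⟨V, hV, h⟩ := hG.weakstar_uniform ε hε
    have hsub := closedBall_subset_closedBall (x := (0 : StrongDual ℂ E)) hr.le
    exact ⟨V, hV, fun x hx y hy => h x (hsub hx) y (hsub hy)⟩

theorem LocallyWeakStarUniform.congr (hG : LocallyWeakStarUniform G) {H : StrongDual ℂ E → ℂ}
    (h : ∀ z ∈ ball (0 : StrongDual ℂ E) 1, H z = G z) : LocallyWeakStarUniform H where
  holomorphic := hG.holomorphic.congr h
  weakstar_uniform r hr ε hε := by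
    obtain ⟨V, hV, hVG⟩ := hG.weakstar_uniform r hr ε hε
    have hsub := closedBall_subset_ball (x := (0 : StrongDual ℂ E)) hr
    refine ⟨V, hV, fun x hx y hy hxy => ?_⟩
    rw [h x (hsub hx), h y (hsub hy)]
    exact hVG x hx y hy hxy

theorem LocallyWeakStarUniform.fderiv_apply (hG : LocallyWeakStarUniform G)
    (v : StrongDual ℂ E) : LocallyWeakStarUniform fun z => fderiv ℂ G z v where
  holomorphic := (hG.holomorphic.fderiv_of_complex isOpen_ball).clm_apply (by fun_prop)
  weakstar_uniform r hr ε hε := by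
    obtain ⟨s, hrs, hs⟩ := exists_between hr
    have hσ : 0 < s - r := by linarith
    have hv : 0 < ‖v‖ + 1 := by positivity
    set ε' := ε * (s - r) / (2 * (‖v‖ + 1)) with hε'
    obtain ⟨V, hV, h⟩ := hG.weakstar_uniform s hs ε' (by positivity)
    refine ⟨V, hV, fun x hx y hy hxy => ?_⟩
    have hsub : ∀ z ∈ closedBall (0 : StrongDual ℂ E) r, ball z (s - r) ⊆ closedBall 0 s :=
      fun z hz => (ball_subset_ball' (by linarith [mem_closedBall.1 hz])).trans
        (ball_subset_closedBall (ε := s))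
    have hd : ∀ z ∈ closedBall (0 : StrongDual ℂ E) r, DifferentiableOn ℂ G (ball z (s - r)) :=
      fun z hz => hG.holomorphic.mono ((hsub z hz).trans (closedBall_subset_ball hs))
    have key := norm_fderiv_sub_fderiv_le hσ (hd x hx) (hd y hy) (ε := ε') fun w hw =>
      (h _ (hsub x hx (by simpa using hw)) _ (hsub y hy (by simpa using hw))
        (by simpa using hxy)).le
    have h2 : 2 * ε' / (s - r) = ε / (‖v‖ + 1) := by rw [hε']; field_simp
    rw [h2] at key
    calc _ = ‖(fderiv ℂ G x - fderiv ℂ G y) v‖ := rfl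
      _ ≤ ε / (‖v‖ + 1) * ‖v‖ := ContinuousLinearMap.le_of_opNorm_le _ key v
      _ < ε / (‖v‖ + 1) * (‖v‖ + 1) := by gcongr; linarith
      _ = ε := by field_simp

theorem LocallyWeakStarUniform.iteratedFDeriv_apply (hG : LocallyWeakStarUniform G) (n : ℕ)
    (z : Fin n → StrongDual ℂ E) : LocallyWeakStarUniform fun w => iteratedFDeriv ℂ n G w z := by
  induction n with
  | zero => simpa using hG
  | succ n ih =>
    refine ((ih (Fin.tail z)).fderiv_apply (z 0)).congr fun w hw => ?_
    have hd := (hG.holomorphic.iteratedFDeriv_of_complex isOpen_ball n).differentiableAt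
      (isOpen_ball.mem_nhds hw)
    rw [iteratedFDeriv_succ_apply_left, fderiv_continuousMultilinear_apply_const_apply hd]

end

variable {X : Type*} [NormedAddCommGroup X] [NormedSpace ℂ X]
  {G : StrongDual ℂ (NormedDual X) → ℂ}

/-- The derivative at a point of a weak-star uniformly continuous holomorphic function on the ball
of `X**` is a weak-star continuous functional: it is the evaluation at its restriction to `X`. -/
theorem LocallyWeakStarUniform.fderiv_eq (hG : LocallyWeakStarUniform G)
    {c : StrongDual ℂ (NormedDual X)} (hc : c ∈ ball 0 1) (z : StrongDual ℂ (NormedDual X)) :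
    fderiv ℂ G c z = z (show NormedDual X from (fderiv ℂ G c).comp (toBidual X)) := by
  have hc' : ‖c‖ < 1 := by simpa using hc
  obtain ⟨s, hcs, hs⟩ := exists_between hc'
  have hσ : 0 < (s - ‖c‖) / (‖z‖ + 1) := 
    div_pos (by linarith) (by positivity)
  obtain ⟨σ, hσ0, hσ1, hσz⟩ : ∃ σ > 0, σ ≤ 1 ∧ σ * ‖z‖ ≤ s - ‖c‖ := by
    refine ⟨min 1 ((s - ‖c‖) / (‖z‖ + 1)), by positivity, min_le_left _ _, ?_⟩
    calc _ ≤ (s - ‖c‖) / (‖z‖ + 1) * (‖z‖ + 1) := by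
          gcongr
          · exact min_le_right _ _
          · linarith
      _ = _ := by field_simp
  set φ : StrongDual ℂ X := (fderiv ℂ G c).comp (toBidual X)
  have := bidualNhds_neBot (le_refl ‖z‖)
  -- Both sides are limits of `φ x` as `x` tends weak-star to `z`.
  refine tendsto_nhds_unique ?_ (tendsto_apply_bidualNhds ‖z‖ z φ)
  rw [Metric.nhds_basis_ball.tendsto_right_iff]
  intro ε hε
  obtain ⟨V, hV, h⟩ := hG.weakstar_uniform s hs (ε * σ / 4) (by positivity)
  have hV' := balancedCore_mem_nhds_zero (𝕜 := ℂ) hV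
  have h1 : Tendsto (fun x : X => StrongDual.toWeakDual (toBidual X x - z)) (bidualNhds ‖z‖ z)
      (𝓝 0) := by
    have := (tendsto_bidualNhds ‖z‖ z).sub_const (StrongDual.toWeakDual z)
    rw [sub_self] at this
    exact this.congr fun x => (map_sub _ _ _).symm
  filter_upwards [h1.eventually hV', eventually_norm_le_bidualNhds ‖z‖ z] with x hx hxz
  have hline : ∀ w : StrongDual ℂ (NormedDual X), ‖w‖ ≤ ‖z‖ → ∀ t ∈ ball (0 : ℂ) σ,
      c + t • w ∈ closedBall (0 : StrongDual ℂ (NormedDual X)) s := by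
    intro w hw t ht
    rw [mem_ball_zero_iff] at ht
    rw [mem_closedBall_zero_iff]
    have : ‖t • w‖ ≤ σ * ‖z‖ := by rw [norm_smul]; gcongr
    linarith [norm_add_le c (t • w)]
  have hx' : ‖toBidual X x‖ ≤ ‖z‖ := by rwa [norm_toBidual]
  have key := norm_fderiv_apply_sub_le isOpen_ball hG.holomorphic (ε := ε * σ / 4) hσ0
    (fun t ht => closedBall_subset_ball hs (hline _ hx' t ht))
    (fun t ht => closedBall_subset_ball hs (hline z le_rfl t ht)) (fun t ht => by
      refine (h _ (hline _ hx' t ht) _ (hline z le_rfl t ht) ?_).le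
      rw [toWeakDual_add_smul_sub_add_smul]
      refine balancedCore_subset V ((balancedCore_balanced (𝕜 := ℂ) V).smul_mem ?_ hx)
      rw [mem_ball_zero_iff] at ht
      linarith)
  have h4 : 2 * (ε * σ / 4) / σ = ε / 2 := by field_simp; ring
  rw [h4] at key
  rw [mem_ball, dist_eq_norm]
  exact key.trans_lt (half_lt_self hε)

/-- On the unit ball of `X`, the Aron–Berner extensions of the derivatives of the restriction of `G`
to `X` are the derivatives of `G`. The variables are extended one at a time: the outermost one is
handled by weak-star continuity of a first derivative of a derivative of lower order. -/
theorem LocallyWeakStarUniform.aronBernerForm_iteratedFDeriv (hG : LocallyWeakStarUniform G) (n : ℕ)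
    (z : Fin n → StrongDual ℂ (NormedDual X)) {y : X} (hy : y ∈ ball (0 : X) 1) :
    aronBernerForm n z (iteratedFDeriv ℂ n (G ∘ toBidual X) y) =
      iteratedFDeriv ℂ n G (toBidual X y) z := by
  have hmem : ∀ {y : X}, y ∈ ball (0 : X) 1 → toBidual X y ∈ ball 0 1 := fun {y} hy => by
    rw [mem_ball_zero_iff] at hy ⊢; rwa [norm_toBidual]
  have hg : DifferentiableOn ℂ (G ∘ toBidual X) (ball 0 1) :=
    hG.holomorphic.comp (toBidual X).differentiable.differentiableOn fun y hy => hmem hy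
  induction n generalizing y with
  | zero =>
    rw [iteratedFDeriv_zero_apply]
    exact iteratedFDeriv_zero_apply (𝕜 := ℂ) (f := G ∘ toBidual X) (x := y) 0
  | succ n ih =>
    set H : StrongDual ℂ (NormedDual X) → ℂ := fun w => iteratedFDeriv ℂ n G w (Fin.tail z) with hH
    have hHc : LocallyWeakStarUniform H := hG.iteratedFDeriv_apply n (Fin.tail z)
    have hHd := hHc.holomorphic.differentiableAt (isOpen_ball.mem_nhds (hmem hy))
    have hnd := (hg.iteratedFDeriv_of_complex isOpen_ball n).differentiableAt
      (isOpen_ball.mem_nhds hy)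
    have hGd := (hG.holomorphic.iteratedFDeriv_of_complex isOpen_ball n).differentiableAt
      (isOpen_ball.mem_nhds (hmem hy))
    have h1 : (iteratedFDeriv ℂ (n + 1) (G ∘ toBidual X) y).curryLeft =
        fderiv ℂ (iteratedFDeriv ℂ n (G ∘ toBidual X)) y := by
      ext v m
      rw [ContinuousMultilinearMap.curryLeft_apply, iteratedFDeriv_succ_apply_left]
      simp
    have h2 : (aronBernerForm n (Fin.tail z)).comp
        (fderiv ℂ (iteratedFDeriv ℂ n (G ∘ toBidual X)) y) =
        (fderiv ℂ H (toBidual X y)).comp (toBidual X) := by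
      have e1 := (aronBernerForm n (Fin.tail z)).hasFDerivAt.comp y hnd.hasFDerivAt
      have e2 := hHd.hasFDerivAt.comp y (toBidual X).hasFDerivAt
      refine e1.unique (e2.congr_of_eventuallyEq ?_)
      filter_upwards [isOpen_ball.mem_nhds hy] with x hx
      exact ih (Fin.tail z) hx
    have h3 := (congrArg (aronBernerForm n (Fin.tail z)).comp h1).trans h2
    refine ((aronBernerForm_succ_apply z _).trans (congrArg (DFunLike.coe (z 0)) h3)).trans ?_
    refine (hHc.fderiv_eq (hmem hy) (z 0)).symm.trans ?_
    rw [iteratedFDeriv_succ_apply_left, hH, fderiv_continuousMultilinear_apply_const_apply hGd]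

end AronBernerSeries

/-! ### The algebra `A_w*u` and the perturbation by peak functions -/

section WeakStarAlgebra

theorem norm_le_ballNorm {E : Type*} [NormedAddCommGroup E] {f : E → ℂ}
    (hf : BddAbove (range fun x : closedBall (0 : E) 1 => ‖f x‖))
    {x : E} (hx : ‖x‖ ≤ 1) : ‖f x‖ ≤ ballNorm f :=
  le_ciSup hf ⟨x, by simpa using hx⟩

theorem ballNorm_le {E : Type*} [NormedAddCommGroup E] {f : E → ℂ} {M : ℝ}
    (hM : ∀ x, ‖x‖ ≤ 1 → ‖f x‖ ≤ M) : ballNorm f ≤ M := by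
  have : Nonempty (closedBall (0 : E) 1) := ⟨⟨0, by simp⟩⟩
  exact ciSup_le fun x => hM x (mem_closedBall_zero_iff.1 x.2)

variable {E : Type*} [NormedAddCommGroup E] [NormedSpace ℂ E]

theorem norm_normalize_sub {z : E} (hz0 : z ≠ 0) (hz : ‖z‖ ≤ 1) :
    ‖(‖z‖⁻¹ : ℂ) • z - z‖ = 1 - ‖z‖ := by
  have hn : 0 < ‖z‖ := norm_pos_iff.2 hz0
  have e : (‖z‖⁻¹ : ℂ) • z - z = ((‖z‖⁻¹ - 1 : ℝ) : ℂ) • z := by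
    push_cast
    rw [sub_smul, one_smul]
  rw [e, norm_smul, Complex.norm_of_nonneg (sub_nonneg.2 ((one_le_inv₀ hn).2 hz))]
  field_simp

namespace MemAwstaru

variable {F G : StrongDual ℂ E → ℂ}

theorem exists_norm_le (hF : MemAwstaru F) :
    ∃ M > 0, ∀ x ∈ closedBall (0 : StrongDual ℂ E) 1, ‖F x‖ ≤ M := by
  obtain ⟨M, hM⟩ := hF.bddAbove
  refine ⟨max M 1, by positivity, fun x hx => ?_⟩
  exact (hM ⟨⟨x, hx⟩, rfl⟩).trans (le_max_left _ _)

theorem const (c : ℂ) : MemAwstaru fun _ : StrongDual ℂ E => c where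
  weakstar_uniform ε hε := ⟨univ, univ_mem, fun x _ y _ _ => by simpa using hε⟩
  holomorphic := differentiableOn_const c

theorem add (hF : MemAwstaru F) (hG : MemAwstaru G) : MemAwstaru fun z => F z + G z where
  weakstar_uniform ε hε := by
    obtain ⟨V, hV, h⟩ := hF.weakstar_uniform (ε / 2) (half_pos hε)
    obtain ⟨W, hW, h'⟩ := hG.weakstar_uniform (ε / 2) (half_pos hε)
    refine ⟨V ∩ W, inter_mem hV hW, fun x hx y hy hxy => ?_⟩
    calc _ = ‖(F x - F y) + (G x - G y)‖ := by congr 1; ring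
      _ ≤ ‖F x - F y‖ + ‖G x - G y‖ := norm_add_le _ _
      _ < ε := by linarith [h x hx y hy hxy.1, h' x hx y hy hxy.2]
  holomorphic := hF.holomorphic.add hG.holomorphic

theorem mul (hF : MemAwstaru F) (hG : MemAwstaru G) : MemAwstaru fun z => F z * G z where
  weakstar_uniform ε hε := by
    obtain ⟨M, hM, hFM⟩ := hF.exists_norm_le
    obtain ⟨N, hN, hGN⟩ := hG.exists_norm_le
    obtain ⟨V, hV, h⟩ := hF.weakstar_uniform (ε / (2 * N)) (by positivity)
    obtain ⟨W, hW, h'⟩ := hG.weakstar_uniform (ε / (2 * M)) (by positivity)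
    refine ⟨V ∩ W, inter_mem hV hW, fun x hx y hy hxy => ?_⟩
    have h1 : ‖F x - F y‖ * ‖G x‖ ≤ ‖F x - F y‖ * N := by gcongr; exact hGN x hx
    have h2 : ‖F y‖ * ‖G x - G y‖ ≤ M * ‖G x - G y‖ := by gcongr; exact hFM y hy
    have h3 := (lt_div_iff₀ (by positivity)).1 (h x hx y hy hxy.1)
    have h4 := (lt_div_iff₀ (by positivity)).1 (h' x hx y hy hxy.2)
    calc _ = ‖(F x - F y) * G x + F y * (G x - G y)‖ := by congr 1; ring
      _ ≤ ‖F x - F y‖ * ‖G x‖ + ‖F y‖ * ‖G x - G y‖ := by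
        refine (norm_add_le _ _).trans_eq ?_
        rw [norm_mul, norm_mul]
      _ < ε := by linarith
  holomorphic := hF.holomorphic.mul hG.holomorphic

theorem pow (hF : MemAwstaru F) (n : ℕ) : MemAwstaru fun z => F z ^ n := by
  induction n with
  | zero => simpa using const 1
  | succ n ih => simpa [pow_succ] using ih.mul hF

theorem continuousOn_weakDual (hF : MemAwstaru F) :
    ContinuousOn (fun z : WeakDual ℂ E => F (WeakDual.toStrongDual z))
      (WeakDual.toStrongDual ⁻¹' closedBall 0 1) := by
  intro z hz
  refine Metric.continuousWithinAt_iff'.2 fun ε hε => ?_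
  obtain ⟨V, hV, h⟩ := hF.weakstar_uniform ε hε
  have h1 : ∀ᶠ w in 𝓝 z, w - z ∈ V := by
    have : Tendsto (fun w => w - z) (𝓝 z) (𝓝 (z - z)) :=
      (continuous_id.sub continuous_const).tendsto z
    rw [sub_self] at this
    exact this.eventually hV
  filter_upwards [mem_nhdsWithin_of_mem_nhds h1, self_mem_nhdsWithin] with w hw hwb
  rw [dist_eq_norm]
  exact h _ hwb _ hz hw

protected theorem continuousOn (hF : MemAwstaru F) :
    ContinuousOn F (closedBall (0 : StrongDual ℂ E) 1) :=
  hF.continuousOn_weakDual.comp (NormedSpace.Dual.toWeakDual_continuous).continuousOn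
    fun _ hz => hz

/-- Functions of `A_w*u(B_{E*})` attain their norm, by weak-star compactness of the ball. -/
theorem exists_forall_norm_le (hF : MemAwstaru F) :
    ∃ z ∈ closedBall (0 : StrongDual ℂ E) 1,
      ∀ w ∈ closedBall (0 : StrongDual ℂ E) 1, ‖F w‖ ≤ ‖F z‖ := by
  obtain ⟨z, hz, h⟩ := (WeakDual.isCompact_closedBall (𝕜 := ℂ) (0 : StrongDual ℂ E)
    1).exists_isMaxOn ⟨0,
      mem_closedBall_self (x := (0 : StrongDual ℂ E)) zero_le_one⟩ hF.continuousOn_weakDual.norm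
  exact ⟨WeakDual.toStrongDual z, hz, fun w hw => h (show StrongDual.toWeakDual w ∈ _ from hw)⟩

/-- By the maximum modulus principle, a maximum of `‖F‖` on the ball may be pushed radially to the
unit sphere. -/
theorem norm_apply_normalize_eq (hF : MemAwstaru F) {z : StrongDual ℂ E} (hz0 : z ≠ 0)
    (hz : ‖z‖ ≤ 1) (hmax : ∀ w ∈ closedBall (0 : StrongDual ℂ E) 1, ‖F w‖ ≤ ‖F z‖) :
    ‖F ((‖z‖⁻¹ : ℂ) • z)‖ = ‖F z‖ := by
  rcases hz.eq_or_lt with h1 | h1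
  · simp [h1]
  let _ : NormedSpace ℝ (StrongDual ℂ E) := NormedSpace.restrictScalars ℝ ℂ _
  have hcl : closure (ball (0 : StrongDual ℂ E) 1) = closedBall 0 1 := closure_ball _ one_ne_zero
  have hd : DiffContOnCl ℂ F (ball 0 1) := ⟨hF.holomorphic, by rw [hcl]; exact hF.continuousOn⟩
  have key := Complex.norm_eqOn_closure_of_isPreconnected_of_isMaxOn
    (convex_ball (0 : StrongDual ℂ E) 1).isPreconnected isOpen_ball hd (c := z) (by simpa using h1)
    fun w hw => hmax w (ball_subset_closedBall hw)
  refine key ?_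
  rw [hcl, mem_closedBall_zero_iff, norm_smul, norm_inv, Complex.norm_real, norm_norm,
    inv_mul_cancel₀ (norm_ne_zero_iff.2 hz0)]

end MemAwstaru

/-- The perturbation step. If `F` almost attains the norm `1` at a point `w` of the sphere, which is
a limit of strong peak points, then adding to `F` a small multiple of a high power of a peak
function makes every maximum of the modulus lie close to `w`. -/
theorem exists_memAwstaru_norm_attaining {F : StrongDual ℂ E → ℂ} (hF : MemAwstaru F)
    (hF1 : ∀ y ∈ closedBall (0 : StrongDual ℂ E) 1, ‖F y‖ ≤ 1) {w : StrongDual ℂ E} (hw : ‖w‖ = 1)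
    (hwS : w ∈ closure (normStrongPeakPoints E)) {ε : ℝ} (hε : 0 < ε) (hFw : 1 - ε / 8 < ‖F w‖) :
    ∃ G : StrongDual ℂ E → ℂ, MemAwstaru G ∧
      (∀ y ∈ closedBall (0 : StrongDual ℂ E) 1, ‖G y‖ ≤ 1) ∧
      (∀ y ∈ closedBall (0 : StrongDual ℂ E) 1, ‖G y - F y‖ ≤ ε / 2) ∧
      ∃ z, ‖z‖ = 1 ∧ ‖G z‖ = 1 ∧ ‖z - w‖ < ε := by
  set c := ε / 4 with hc_def
  have hc : 0 < c := by positivity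
  obtain ⟨δ, hδ, hδ1, hδε⟩ : ∃ δ > 0, δ < 1 ∧ 3 * δ < ε := by
    have h1 := min_le_left (ε / 4) (1 / 2)
    have h2 := min_le_right (ε / 4) (1 / 2)
    exact ⟨min (ε / 4) (1 / 2), by positivity, by linarith, by linarith⟩
  obtain ⟨z, ⟨hz, h, hhA, hh1, hhz, hpeak⟩, hzw, hFz⟩ :
      ∃ z ∈ normStrongPeakPoints E, ‖z - w‖ < δ ∧ 1 - ε / 8 < ‖F z‖ := by
    have h1 : ∀ᶠ z in 𝓝 w, z ∈ closedBall (0 : StrongDual ℂ E) 1 → 1 - ε / 8 < ‖F z‖ :=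
      eventually_nhdsWithin_iff.1 ((hF.continuousOn w (by simp [hw])).norm.eventually
        (lt_mem_nhds hFw))
    obtain ⟨z, ⟨hz1, hz2⟩, hzS⟩ := mem_closure_iff_nhds.1 hwS _
      (inter_mem h1 (ball_mem_nhds w hδ))
    refine ⟨z, hzS, by simpa [dist_eq_norm] using hz2, hz1 (mem_closedBall_zero_iff.2 hzS.1.le)⟩
  have hh : ∀ y ∈ closedBall (0 : StrongDual ℂ E) 1, ‖h y‖ ≤ 1 := fun y hy => by
    rw [← hh1]
    exact norm_le_ballNorm hhA.bddAbove (by simpa using hy)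
  set s := max (sSup ((fun y => ‖h y‖) '' (closedBall (0 : StrongDual ℂ E) 1 \ ball z δ))) 0
  have hs1 : s < 1 := max_lt (hpeak δ hδ) one_pos
  have hs : ∀ y ∈ closedBall (0 : StrongDual ℂ E) 1, y ∉ ball z δ → ‖h y‖ ≤ s := fun y hy hyz => by
    refine le_max_of_le_left (le_csSup ⟨1, ?_⟩ ⟨y, ⟨hy, hyz⟩, rfl⟩)
    rintro _ ⟨x, hx, rfl⟩
    exact hh x hx.1
  obtain ⟨n, hn⟩ := exists_pow_lt_of_lt_one one_half_pos hs1
  -- The phase `ω` aligns the perturbation `c * ω * h ^ n` with `F` at the peak point `z`.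
  obtain ⟨ω, hω, hωz⟩ : ∃ ω : ℂ, ‖ω‖ = 1 ∧ ‖F z + c * ω * h z ^ n‖ = ‖F z‖ + c := by
    obtain ⟨d, hd, hdz⟩ := RCLike.exists_norm_eq_mul_self (F z)
    have hd0 : d ≠ 0 := norm_ne_zero_iff.1 (by rw [hd]; exact one_ne_zero)
    have ha : ‖h z ^ n‖ = 1 := by rw [norm_pow, hhz, one_pow]
    have ha0 : h z ^ n ≠ 0 := norm_ne_zero_iff.1 (by rw [ha]; exact one_ne_zero)
    refine ⟨d⁻¹ * (h z ^ n)⁻¹, by rw [norm_mul, norm_inv, norm_inv, hd, ha]; simp, ?_⟩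
    have e : d * (F z + c * (d⁻¹ * (h z ^ n)⁻¹) * h z ^ n) = ((‖F z‖ + c : ℝ) : ℂ) := by
      push_cast
      rw [show ((‖F z‖ : ℝ) : ℂ) = d * F z from hdz]
      field_simp
    have e' := congrArg norm e
    rwa [norm_mul, hd, one_mul, Complex.norm_of_nonneg (by positivity)] at e'
  set G : StrongDual ℂ E → ℂ := fun y => F y + c * ω * h y ^ n
  have hG : MemAwstaru G := hF.add ((MemAwstaru.const (c * ω)).mul (hhA.pow n))
  have hpert : ∀ y, ‖c * ω * h y ^ n‖ = c * ‖h y‖ ^ n := fun y => by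
    rw [norm_mul, norm_mul, norm_pow, hω, Complex.norm_of_nonneg hc.le, mul_one]
  obtain ⟨z₁, hz₁, hmax⟩ := hG.exists_forall_norm_le
  set M := ‖G z₁‖
  have hM : 1 + c / 2 < M := by
    have h1 := hmax z (by simpa using hz.le)
    have h2 : ‖G z‖ = ‖F z‖ + c := hωz
    linarith
  have hM' : M ≤ 1 + c := by
    refine (norm_add_le _ _).trans (add_le_add (hF1 z₁ hz₁) ?_)
    rw [hpert]
    exact mul_le_of_le_one_right hc.le (pow_le_one₀ (norm_nonneg _) (hh z₁ hz₁))
  have hz₁z : z₁ ∈ ball z δ := by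
    by_contra hcon
    have h1 : M ≤ 1 + c * ‖h z₁‖ ^ n := by
      rw [← hpert]
      exact (norm_add_le _ _).trans (add_le_add_left (hF1 z₁ hz₁) _)
    have h2 : ‖h z₁‖ ^ n ≤ s ^ n := pow_le_pow_left₀ (norm_nonneg _) (hs z₁ hz₁ hcon) n
    nlinarith
  have hn1 : ‖z₁‖ ≤ 1 := by simpa using hz₁
  have hn2 : 1 - δ < ‖z₁‖ := by
    have h1 : ‖z₁ - z‖ < δ := by simpa [dist_eq_norm] using hz₁z
    have h2 := norm_sub_norm_le z z₁
    rw [norm_sub_rev] at h2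
    linarith
  have hn0 : 0 < ‖z₁‖ := by linarith
  have hM0 : 0 < M := by linarith
  refine ⟨fun y => (M⁻¹ : ℂ) * G y, (MemAwstaru.const _).mul hG, fun y hy => ?_, fun y hy => ?_,
    (‖z₁‖⁻¹ : ℂ) • z₁, ?_, ?_, ?_⟩
  · rw [norm_mul, norm_inv, Complex.norm_of_nonneg hM0.le, inv_mul_le_iff₀ hM0, mul_one]
    exact hmax y hy
  · have h1 : ‖G y - F y‖ ≤ c := by
      simp only [G, add_sub_cancel_left]
      rw [hpert]
      exact mul_le_of_le_one_right hc.le (pow_le_one₀ (norm_nonneg _) (hh y hy))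
    have h2 : ‖(M⁻¹ : ℂ) * G y - G y‖ ≤ c := by
      have e : (M⁻¹ : ℂ) * G y - G y = -(((1 - M⁻¹ : ℝ) : ℂ) * G y) := by push_cast; ring
      have hM1 : 0 ≤ 1 - M⁻¹ := sub_nonneg.2 (inv_le_one_of_one_le₀ (by linarith))
      rw [e, norm_neg, norm_mul, Complex.norm_of_nonneg hM1]
      calc _ ≤ (1 - M⁻¹) * M := by gcongr; exact hmax y hy
        _ = M - 1 := by field_simp
        _ ≤ c := by linarith
    calc _ = ‖((M⁻¹ : ℂ) * G y - G y) + (G y - F y)‖ := by congr 1; ring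
      _ ≤ c + c := (norm_add_le _ _).trans (add_le_add h2 h1)
      _ = ε / 2 := by rw [hc_def]; ring
  · rw [norm_smul, norm_inv, Complex.norm_real, norm_norm, inv_mul_cancel₀ hn0.ne']
  · rw [norm_mul, hG.norm_apply_normalize_eq (norm_pos_iff.1 hn0) hn1 hmax, norm_inv,
      Complex.norm_of_nonneg hM0.le, inv_mul_cancel₀ hM0.ne']
  · have h1 := norm_normalize_sub (norm_pos_iff.1 hn0) hn1
    have h2 : ‖z₁ - z‖ < δ := by simpa [dist_eq_norm] using hz₁z
    have h3 := norm_sub_le_norm_sub_add_norm_sub ((‖z₁‖⁻¹ : ℂ) • z₁) z₁ w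
    have h4 := norm_sub_le_norm_sub_add_norm_sub z₁ z w
    linarith

end WeakStarAlgebra

/-! ### Restriction from the ball of `X**` to the ball of `X` -/

section Restriction

variable {X : Type*} [NormedAddCommGroup X] [NormedSpace ℂ X]
  {G : StrongDual ℂ (NormedDual X) → ℂ}

theorem MemAwstaru.memAwu_comp_toBidual (hG : MemAwstaru G) : MemAwu (G ∘ toBidual X) where
  weak_uniform ε hε := by
    obtain ⟨V, hV, h⟩ := hG.weakstar_uniform ε hε
    have hJ : ∀ x ∈ closedBall (0 : X) 1, toBidual X x ∈ closedBall 0 1 := fun x hx => by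
      rw [mem_closedBall_zero_iff] at hx ⊢
      rwa [norm_toBidual]
    have hcont := (NormedSpace.inclusionInDoubleDualWeak ℂ X).continuous.tendsto 0
    rw [map_zero] at hcont
    refine ⟨_, hcont hV, fun x hx y hy hxy => h _ (hJ x hx) _ (hJ y hy) ?_⟩
    rw [← map_sub]
    exact hxy
  holomorphic := hG.holomorphic.comp (toBidual X).differentiable.differentiableOn fun x hx => by
    rw [mem_ball_zero_iff] at hx ⊢
    rwa [norm_toBidual]

theorem MemAwstaru.tendsto_comp_toBidual (hG : MemAwstaru G) {z : StrongDual ℂ (NormedDual X)}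
    (hz : ‖z‖ ≤ 1) : Tendsto (G ∘ toBidual X) (bidualNhds 1 z) (𝓝 (G z)) := by
  have h := hG.continuousOn_weakDual (StrongDual.toWeakDual z) (mem_closedBall_zero_iff.2 hz)
  refine h.tendsto.comp (tendsto_nhdsWithin_iff.2 ⟨tendsto_bidualNhds 1 z, ?_⟩)
  filter_upwards [eventually_norm_le_bidualNhds 1 z] with x hx
  refine mem_closedBall_zero_iff.2 ?_
  exact (norm_toBidual x).trans_le hx

/-- A function of `A_w*u(B_X**)` is the Aron–Berner extension of its restriction to `X`. -/
theorem MemAwstaru.isAronBernerExtension (hG : MemAwstaru G) :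
    IsAronBernerExtension (G ∘ toBidual X) G where
  hasSum z hz := by
    have h := hG.holomorphic.hasSum_taylor_of_complex (z := z) hz
    refine h.congr_fun fun n => ?_
    rw [smul_eq_mul]
    congr 1
    have h0 := hG.locallyWeakStarUniform.aronBernerForm_iteratedFDeriv n (fun _ => z)
      (mem_ball_self (x := (0 : X)) one_pos)
    rw [map_zero] at h0
    exact h0
  continuousOn := hG.continuousOn

end Restriction

end

theorem mainTheorem5 (X : Type*) [NormedAddCommGroup X] [NormedSpace ℂ X] [CompleteSpace X]
    (hdense : {z : StrongDual ℂ (StrongDual ℂ X) | ‖z‖ = 1} ⊆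
      closure (normStrongPeakPoints (StrongDual ℂ X)))
    (ε : ℝ) (hε : 0 < ε) :
    ∃ η : ℝ, 0 < η ∧
      ∀ f : X → ℂ, MemAwu f → ballNorm f = 1 →
        ∀ x₀ : X, ‖x₀‖ = 1 → 1 - η < ‖f x₀‖ →
          ∃ g : X → ℂ, MemAwu g ∧ ballNorm g = 1 ∧
            ∃ ABg : StrongDual ℂ (StrongDual ℂ X) → ℂ,
              IsAronBernerExtension g ABg ∧ MemAwstaru ABg ∧
              ∃ z₀ : StrongDual ℂ (StrongDual ℂ X), ‖z₀‖ = 1 ∧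
                ‖ABg z₀‖ = 1 ∧ ballNorm (g - f) < ε ∧
                ‖z₀ - NormedSpace.inclusionInDoubleDual ℂ X x₀‖ < ε := by
  refine ⟨ε / 8, by positivity, fun f hf hf1 x₀ hx₀ hfx₀ => ?_⟩
  have hu : WeakUniformContinuousOnBall 1 f := hf.weak_uniform
  have hfle : ∀ x : X, ‖x‖ ≤ 1 → ‖f x‖ ≤ 1 := fun x hx => by
    rw [← hf1]
    exact norm_le_ballNorm hf.bddAbove hx
  have hJx₀ : ‖toBidual X x₀‖ = 1 := by rw [norm_toBidual, hx₀]
  obtain ⟨G, hG, hG1, hGF, z₀, hz₀, hGz₀, hz₀x₀⟩ :=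
    exists_memAwstaru_norm_attaining hf.memAwstaru_bidualExtension
      (fun y hy => norm_bidualExtension_le hu hfle (by simpa using hy)) hJx₀ (hdense hJx₀) hε
      (by rwa [bidualExtension_toBidual hu hx₀.le])
  have hg : MemAwu (G ∘ toBidual X) := hG.memAwu_comp_toBidual
  refine ⟨G ∘ toBidual X, hg, le_antisymm (ballNorm_le fun x hx => ?_) ?_, G,
    hG.isAronBernerExtension, hG, z₀, hz₀, hGz₀, ?_, hz₀x₀⟩
  · exact hG1 _ (by rwa [mem_closedBall_zero_iff, norm_toBidual])
  · -- The ball of `X` is weak-star dense in that of `X**`, so `g` and `G` have the same norm.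
    have := bidualNhds_neBot (X := X) (z := z₀) hz₀.le
    rw [← hGz₀]
    refine le_of_tendsto (hG.tendsto_comp_toBidual hz₀.le).norm ?_
    filter_upwards [eventually_norm_le_bidualNhds 1 z₀] with x hx
    exact norm_le_ballNorm hg.bddAbove hx
  · refine (ballNorm_le fun x hx => ?_).trans_lt (half_lt_self hε)
    have h := hGF (toBidual X x) (by rwa [mem_closedBall_zero_iff, norm_toBidual])
    rwa [bidualExtension_toBidual hu hx] at h
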